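/- Let $M$ be a connected smooth 3-manifold with compact boundary $\partial M$, with smooth (up to the boundary) Riemannian metric $g$ and smooth symmetric 2-tensor $k$. Let $\tau(x)=\mathrm{dist}(x,\partial M)$, and let $\tau_0>0$ be small enough that $\tau$ is smooth up to the boundary on the collar $\{\tau<\tau_0\}$ (such $\tau_0$ exists, since $\partial M$ is compact). Let $S_\tau$ be the level sets of $\tau$ and $\theta_+(S_\tau)=H_{S_\tau}+\mathrm{Tr}_{S_\tau}k$, where $H_{S_\tau}$ is the mean curvature with respect to the unit normal $\nabla\tau$. For functions $\phi$ and $f$ write $$H(f)-K(f)=\Big(g^{ij}-\frac{\phi^2f^if^j}{1+\phi^2|\nabla f|^2}\Big)\Big(\frac{\phi\nabla_{ij}f+\phi_if_j+\phi_jf_i}{\sqrt{1+\phi^2|\nabla f|^2}}-k_{ij}\Big)$$ for the generalized Jang operator; $f$ is a subsolution (supersolution) of the generalized Jang equation if $H(f)-K(f)\ge 0$ ($\le 0$). Assume that, for some $b\ge 0$, $$\phi=\tau^b\widetilde\phi\quad\text{on }\{\tau<\tau_0\},\tag{14}$$ where $\widetilde\phi$ is strictly positive and smooth up to the boundary. Let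 $l,c>0$ be constants. For $p\ge 0$ put $P_p(\tau)=\tau^{-p}$ if $p>0$ and $P_0(\tau)=-\log\tau$. (1) Suppose that $-\frac{l-1}{2}\le b<\frac{l+1}{2}$ and $$c^{-1}\tau^l\le\theta_+(S_\tau)\le c\,\tau^l\quad\text{for }0<\tau<\tau_0.\tag{12}$$ Then for every $\lambda>0$ there are $\tau_1\in(0,\tau_0]$, positive constants $\alpha,\beta$ and smooth functions $\underline\psi,\overline\psi$ on $(0,\tau_1)$ such that each $\psi\in\{\underline\psi,\overline\psi\}$ satisfies $\psi'<0$, $|\phi\,\psi'(\tau)|\to\infty$ uniformly as $\tau\to0$, and $$\alpha^{-1}P_p(\tau)+\beta^{-1}\le\psi(\tau)\le\alpha P_p(\tau)+\beta\quad\text{on }(0,\tau_1),\qquad p=b+\tfrac{l-1}{2},$$ and, on $\{0<\tau<\tau_1\}$, the radial functions $\underline\psi(\tau(x))$, $\overline\psi(\tau(x))$ are a sub- and a supersolution with $$H(\underline\psi)-K(\underline\psi)\ge\lambda\tau^l,\qquad H(\overline\psi)-K(\overline\psi)\le-\frac{c^{-1}}{2}\tau^l.$$ (2) Suppose that $\frac12\le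 b<\frac{l+1}{2}$ and $$|\theta_+(S_\tau)|\le c\,\tau^l\quad\text{for }0<\tau<\tau_0.\tag{15}$$ Then for every $\widetilde l$ with $2b-1<\widetilde l\le\min(l,2b)$ and every $\lambda>0$ there are $\tau_1\in(0,\tau_0]$, positive constants $\alpha,\beta$ and smooth functions $\underline\chi,\overline\chi$ on $(0,\tau_1)$ such that each $\chi\in\{\underline\chi,\overline\chi\}$ satisfies $\chi'<0$, $|\phi\,\chi'(\tau)|\to\infty$ uniformly as $\tau\to0$, and $$\alpha^{-1}P_p(\tau)+\beta^{-1}\le\chi(\tau)\le\alpha P_p(\tau)+\beta\quad\text{on }(0,\tau_1),\qquad p=2b-1,$$ and, on $\{0<\tau<\tau_1\}$, the radial functions $\underline\chi(\tau(x))$, $\overline\chi(\tau(x))$ are a sub- and a supersolution with $$H(\underline\chi)-K(\underline\chi)\ge\lambda\tau^{\widetilde l},\qquad H(\overline\chi)-K(\overline\chi)\le-\lambda\tau^{\widetilde l}.$$ -/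

import Mathlib

open Set Filter Topology Bundle Manifold
open scoped ContDiff

noncomputable section

namespace Jang

/-- The tangent space of a three-manifold with boundary. -/
local notation "𝕋" => TangentSpace (modelWithCornersEuclideanHalfSpace 3)

/-- The metric trace of a bilinear form `B` on a finite-dimensional inner product space:
`∑ i, B (e i) (e i)` for an orthonormal basis `e`. In coordinates this is `g^{ij} B_{ij}`. -/
def trace {V : Type*} [NormedAddCommGroup V] [InnerProductSpace ℝ V] [FiniteDimensional ℝ V]
    (B : V → V → ℝ) : ℝ :=
  ∑ i, B (stdOrthonormalBasis ℝ V i) (stdOrthonormalBasis ℝ V i)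

section Geometry

variable {M : Type*} [TopologicalSpace M] [ChartedSpace (EuclideanHalfSpace 3) M]

instance (x : M) : FiniteDimensional ℝ (𝕋 x) :=
  inferInstanceAs (FiniteDimensional ℝ (EuclideanSpace ℝ (Fin 3)))

/-- The differential of a real function at `x`, as a linear form on the tangent space. -/
abbrev diff (f : M → ℝ) (x : M) : 𝕋 x →L[ℝ] ℝ :=
  mvfderiv (modelWithCornersEuclideanHalfSpace 3) f x

variable [RiemannianBundle (fun x : M => 𝕋 x)]

instance (x : M) : CompleteSpace (𝕋 x) := FiniteDimensional.complete ℝ _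

/-- The Riemannian gradient: `⟨∇f, v⟩ = df(v)`. -/
def grad (f : M → ℝ) (x : M) : 𝕋 x :=
  (InnerProductSpace.toDual ℝ (𝕋 x)).symm (diff f x)

variable [IsManifold (modelWithCornersEuclideanHalfSpace 3) ∞ M]

/-- The vector field near `x` with value `v` at `x` whose components in the coordinates of the
preferred chart at `x` are constant. -/
def coordField (x : M) (v : 𝕋 x) (y : M) : 𝕋 y :=
  FiberBundle.extend (EuclideanSpace ℝ (Fin 3)) v y

/-- The Christoffel symbol of the first kind of the Levi-Civita connection at `x`, in the
coordinates of the chart at `x`: with `U, V, W` the constant-coefficient (hence commuting) fields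
through `u, v, w`,
`⟨∇_U V, W⟩ = (U⟨V, W⟩ + V⟨U, W⟩ - W⟨U, V⟩) / 2`. -/
def christoffel (x : M) (u v w : 𝕋 x) : ℝ :=
  (diff (fun y => inner ℝ (coordField x v y) (coordField x w y)) x u
    + diff (fun y => inner ℝ (coordField x u y) (coordField x w y)) x v
    - diff (fun y => inner ℝ (coordField x u y) (coordField x v y)) x w) / 2

/-- The covariant Hessian `∇_{ij} f = ∂_i ∂_j f - Γ_{ij}^m ∂_m f`, as a bilinear form on `T_x M`.
Being a tensor, it does not depend on the coordinates used. -/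
def hessian (f : M → ℝ) (x : M) (v w : 𝕋 x) : ℝ :=
  diff (fun y => diff f y (coordField x w y)) x v - christoffel x v w (grad f x)

/-- The tangent space at `x` of the level set of `u` through `x`. -/
def levelTangent (u : M → ℝ) (x : M) : Submodule ℝ (𝕋 x) :=
  LinearMap.ker (diff u x : 𝕋 x →ₗ[ℝ] ℝ)

/-- The mean curvature `H` at `x` of the level set of `u` through `x`, with respect to the unit
normal `n = ∇u / |∇u|`: the trace over the tangent space of the level set of the second fundamental
form `A(X, Y) = ⟨∇_X n, Y⟩ = ∇²u(X, Y) / |∇u|`. -/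
def levelMeanCurvature (u : M → ℝ) (x : M) : ℝ :=
  trace (V := levelTangent u x) (fun v w => hessian u x v w / ‖grad u x‖)

/-- The null expansion `θ₊ = H_S + Tr_S k` at `x` of the level set `S` of `u` through `x`. -/
def nullExpansion (k : ∀ x : M, 𝕋 x →L[ℝ] 𝕋 x →L[ℝ] ℝ) (u : M → ℝ) (x : M) : ℝ :=
  levelMeanCurvature u x + trace (V := levelTangent u x) (fun v w => k x v w)

/-- The tensor
`(φ ∇_{ij} f + φ_i f_j + φ_j f_i) / √(1 + φ² |∇f|²) - k_{ij}`. -/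
def jangTensor (φ : M → ℝ) (k : ∀ x : M, 𝕋 x →L[ℝ] 𝕋 x →L[ℝ] ℝ) (f : M → ℝ) (x : M)
    (v w : 𝕋 x) : ℝ :=
  (φ x * hessian f x v w + diff φ x v * diff f x w + diff φ x w * diff f x v)
    / √(1 + φ x ^ 2 * ‖grad f x‖ ^ 2) - k x v w

/-- The generalized Jang operator `H(f) - K(f)`: the contraction of the tensor above with
`g^{ij} - φ² f^i f^j / (1 + φ² |∇f|²)`. -/
def jangOperator (φ : M → ℝ) (k : ∀ x : M, 𝕋 x →L[ℝ] 𝕋 x →L[ℝ] ℝ) (f : M → ℝ) (x : M) : ℝ :=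
  trace (jangTensor φ k f x)
    - φ x ^ 2 / (1 + φ x ^ 2 * ‖grad f x‖ ^ 2) * jangTensor φ k f x (grad f x) (grad f x)

end Geometry

section Radial

variable (M : Type*) [MetricSpace M] [ChartedSpace (EuclideanHalfSpace 3) M]

/-- `τ(x) = dist(x, ∂M)`. -/
def bdryDist (x : M) : ℝ :=
  Metric.infDist x ((modelWithCornersEuclideanHalfSpace 3).boundary M)

variable {M}

/-- The model blow-up profile `t^{-p}`, replaced by `-log t` when `p = 0`. -/
def profile (p t : ℝ) : ℝ := if p = 0 then -Real.log t else t ^ (-p)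

/-- `ψ` is a smooth, strictly decreasing function on `(0, τ₁)`, with
`α⁻¹ P + β⁻¹ ≤ ψ ≤ α P + β` for the profile `P` of exponent `p`, and
`|φ ψ'(τ)| → ∞` (uniformly) as `τ → 0`. -/
structure IsRadialProfile (φ : M → ℝ) (τ₁ p α β : ℝ) (ψ : ℝ → ℝ) : Prop where
  smooth : ContDiffOn ℝ ∞ ψ (Ioo 0 τ₁)
  deriv_neg : ∀ t ∈ Ioo 0 τ₁, deriv ψ t < 0
  blowup : Tendsto (fun x : M => |φ x * deriv ψ (bdryDist M x)|)
    (comap (bdryDist M) (𝓝[>] 0)) atTop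
  lower : ∀ t ∈ Ioo 0 τ₁, α⁻¹ * profile p t + β⁻¹ ≤ ψ t
  upper : ∀ t ∈ Ioo 0 τ₁, ψ t ≤ α * profile p t + β

end Radial

end Jang

end

/-! Write `t = τ(x)` and `v = φ|ψ'|`. In the collar `|∇τ| = 1`, so `∇²τ(∇τ, ∇τ) = 0`, and for radial
`ψ` with `ψ' < 0` the Jang operator becomes `J(ψ) = -v/√(1+v²) H - Tr_S k + (1+v²)⁻¹ ((φψ'' + 2 φ_n
ψ')/√(1+v²) - k(n,n))`, `n = ∇τ`. As `v → ∞` the first two terms tend to `-θ₊`, with an error of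
order `v⁻²`. The ansatz `ψ' = -A t^{-q} (1 + σ t^s)` gives `J + θ₊ = (A² φtilde² (1+σt^s)²)⁻¹
t^{2q-2b-1} (ρ (q - 2b - σ s t^s/(1+σt^s) + O(t)) + O(t))`, `1/2 ≤ ρ ≤ 1`
(`jangOperator_radialFun`).

Part (1): take `σ = 0` and `q = p + 1` with `p = b + (l-1)/2`. The power of `t` is then exactly `l`,
and the coefficient `q - 2b = (l+1)/2 - b` is positive. A small `A` makes the right side beat `θ₊ ≤
c t^l` with room `λ`; a large `A` makes it at most half of the lower bound on `θ₊`.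

Part (2): `θ₊` has no sign, so `q = 2b` is chosen to cancel the leading coefficient. The correction
`-σ s t^s` then decides the sign through that of `σ`. With `s = ltilde - (2b-1)`, which lies in `(0,
1]`, it dominates the `O(t)` errors once `|σ|` is large and has total order `t^ltilde`, which also
dominates `θ₊`.

The geometric input is `norm_grad_bdryDist` (eikonal equation), `jangOperator_comp` (the radial
formula) and `exists_collar_bounds` (uniform constants from compactness of the boundary); the rest
is one-variable estimation. -/

noncomputable section

namespace Jang

local notation "𝕀" => modelWithCornersEuclideanHalfSpace 3
local notation "𝕋" => TangentSpace (modelWithCornersEuclideanHalfSpace 3)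

/-! ### Local bounds for covectors and bilinear forms on a continuous Riemannian bundle. -/

section VectorBundle
variable {B : Type*} [TopologicalSpace B] {F : Type*} [NormedAddCommGroup F] [NormedSpace ℝ F]
  {V : B → Type*} [TopologicalSpace (TotalSpace F V)] [∀ x, NormedAddCommGroup (V x)]
  [∀ x, InnerProductSpace ℝ (V x)] [FiberBundle F V] [VectorBundle ℝ F V]
  [IsContinuousRiemannianBundle F V]

/-- The fibre norm changes with `y`, so `α y` is transported to the fixed fibre over `x` through the
trivialization, where continuity applies. Transport costs a factor arbitrarily close to 1 near `x`,
which the gap between `‖α x‖` and `r` absorbs. -/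
theorem eventually_norm_dual_lt {α : ∀ y, V y →L[ℝ] ℝ} {x : B}
    (hα : ContinuousAt (fun y => (α y).comp ((trivializationAt F V x).symmL ℝ y)) x) {r : ℝ}
    (hr : ‖α x‖ < r) : ∀ᶠ y in 𝓝 x, ‖α y‖ < r := by
  set T := trivializationAt F V x
  have hx : x ∈ T.baseSet := FiberBundle.mem_baseSet_trivializationAt' x
  have h2 : ContinuousAt (fun y => ((α y).comp (T.symmL ℝ y)).comp
    (T.continuousLinearMapAt ℝ x)) x := hα.clm_comp continuousAt_const
  obtain ⟨r₁, hr₁, hr₁r⟩ := exists_between hr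
  have r₁pos : 0 < r₁ := (norm_nonneg _).trans_lt hr₁
  have e1 : ∀ᶠ y in 𝓝 x, ‖((α y).comp (T.symmL ℝ y)).comp
      (T.continuousLinearMapAt ℝ x)‖ < r₁ := by
    refine h2.norm.eventually_lt continuousAt_const ?_
    have hαx : ((α x).comp (T.symmL ℝ x)).comp (T.continuousLinearMapAt ℝ x) = α x := by
      ext v
      simp only [ContinuousLinearMap.comp_apply]
      rw [T.symmL_continuousLinearMapAt hx]
    rwa [hαx]
  filter_upwards [e1, eventually_norm_symmL_trivializationAt_self_comp_lt F
    V x (r := r / r₁) (by rwa [one_lt_div r₁pos]),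
    T.open_baseSet.mem_nhds hx] with y h1 h2 hy
  have : α y = (((α y).comp (T.symmL ℝ y)).comp
      (T.continuousLinearMapAt ℝ x)).comp ((T.symmL ℝ x).comp (T.continuousLinearMapAt ℝ y)) := by
    ext v
    simp only [ContinuousLinearMap.comp_apply]
    rw [T.continuousLinearMapAt_symmL hx, T.symmL_continuousLinearMapAt hy]
  rw [this]
  calc _ ≤ _ := ContinuousLinearMap.opNorm_comp_le _ _
    _ < r₁ * (r / r₁) := mul_lt_mul'' h1 h2 (norm_nonneg _) (norm_nonneg _)
    _ = r := by field_simp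

theorem exists_eventually_abs_apply₂_le {k : ∀ x, V x →L[ℝ] V x →L[ℝ] ℝ} {x : B}
    (hk : ContinuousAt (fun y => ContinuousLinearMap.inCoordinates F V 
    (F →L[ℝ] ℝ) (fun x => V x →L[ℝ] Bundle.Trivial B ℝ x) x y x y (k y)) x) :
    ∃ C, ∀ᶠ y in 𝓝 x, ∀ v w : V y, |k y v w| ≤ C * ‖v‖ * ‖w‖ := by
  set T := trivializationAt F V x
  have hx : x ∈ T.baseSet := FiberBundle.mem_baseSet_trivializationAt' x
  obtain ⟨C, Cpos, hC⟩ := eventually_norm_trivializationAt_lt F V x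
  obtain ⟨K, hK⟩ : ∃ K, ∀ᶠ y in 𝓝 x, ‖ContinuousLinearMap.inCoordinates F V
    (F →L[ℝ] ℝ) (fun x => V x →L[ℝ] Bundle.Trivial B ℝ x) x y x y (k y)‖ < K :=
     ⟨_, hk.norm.eventually_lt continuousAt_const (lt_add_one _)⟩
  refine ⟨K * C * C, ?_⟩
  filter_upwards [hC, hK, T.open_baseSet.mem_nhds hx] with y h1 h2 hy v w
  have key := inCoordinates_apply_eq₂ (E₁ := V) (E₂ := V)
    (E₃ := Bundle.Trivial B ℝ) (F₁ := F) (F₂ := F) (F₃ := ℝ) (ϕ := k y) (x₀ := x) (x := y) hy hy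
    (Set.mem_univ _) (v := T.continuousLinearMapAt ℝ y v) (w := T.continuousLinearMapAt ℝ y w)
  have hs : ∀ v, T.symm y (T.continuousLinearMapAt ℝ y v) = v := fun v =>
    (T.symmL_apply hy _).symm.trans (T.symmL_continuousLinearMapAt hy v)
  rw [hs, hs] at key
  simp only [Trivial.fiberBundle_trivializationAt', Trivial.linearMapAt_trivialization,
    LinearMap.id_coe, id_eq] at key
  rw [← key, ← Real.norm_eq_abs]
  have b : ∀ v, ‖T.continuousLinearMapAt ℝ y v‖ ≤ C * ‖v‖ := fun v =>
    (ContinuousLinearMap.le_opNorm _ _).trans (by gcongr)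
  have Kpos : 0 ≤ K := (norm_nonneg _).trans h2.le
  calc _ ≤ _ := ContinuousLinearMap.le_opNorm₂ _ _ _
    _ ≤ K * (C * ‖v‖) * (C * ‖w‖) := by gcongr <;> apply b
    _ = _ := by ring

end VectorBundle

variable {E : Type*} [NormedAddCommGroup E] [NormedSpace ℝ E]
  {H : Type*} [TopologicalSpace H] {I : ModelWithCorners ℝ E H}
  {M : Type*} [TopologicalSpace M] [ChartedSpace H M]

theorem contMDiffAt_mvfderiv_comp_symmL [IsManifold I 1 M] {m n : WithTop ℕ∞} [IsManifold I n M]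
    {u : M → ℝ} {x : M} (hu : ContMDiffAt I 𝓘(ℝ, ℝ) n u x) (hmn : m + 1 ≤ n) :
    ContMDiffAt I 𝓘(ℝ, E →L[ℝ] ℝ) m
      (fun y => (mvfderiv I u y).comp
        ((trivializationAt E (TangentSpace I) x).symmL ℝ y)) x := by
  have h := hu.mfderiv_const hmn
  refine h.congr_of_eventuallyEq (Eventually.of_forall fun y => ?_)
  ext v
  simp [inTangentCoordinates, ContinuousLinearMap.inCoordinates, mvfderiv]
  rfl

variable [IsManifold I 1 M] [RiemannianBundle (fun x : M => TangentSpace I x)]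
  [IsContinuousRiemannianBundle E (fun x : M => TangentSpace I x)]

theorem eventually_norm_mvfderiv_lt {u : M → ℝ} {x : M} (hu : ContMDiffAt I 𝓘(ℝ, ℝ) 1 u x)
    {r : ℝ} (hr : ‖mvfderiv I u x‖ < r) : ∀ᶠ y in 𝓝 x, ‖mvfderiv I u y‖ < r :=
  eventually_norm_dual_lt (V := fun x : M => TangentSpace I x) (α := mvfderiv I u)
    (contMDiffAt_mvfderiv_comp_symmL (m := 0) hu le_rfl).continuousAt hr

theorem exists_eventually_abs_apply_le
    {k : ∀ x : M, TangentSpace I x →L[ℝ] TangentSpace I x →L[ℝ] ℝ}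
    (hk : Continuous (fun x => TotalSpace.mk' (E →L[ℝ] E →L[ℝ] ℝ)
        (E := fun x : M => TangentSpace I x →L[ℝ] TangentSpace I x →L[ℝ] ℝ) x (k x))) (x : M) :
    ∃ C, ∀ᶠ y in 𝓝 x, ∀ v w : TangentSpace I y, |k y v w| ≤ C * ‖v‖ * ‖w‖ := by
  have h := hk.continuousAt (x := x)
  simp only [continuousAt_hom_bundle] at h
  exact exists_eventually_abs_apply₂_le (V := fun x : M => TangentSpace I x) h.2

/-! ### First-order calculus along chart lines through interior points. -/

section Interior
open scoped NNReal ENNReal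
open MeasureTheory
variable {E : Type*} [NormedAddCommGroup E] [NormedSpace ℝ E]
  {H : Type*} [TopologicalSpace H] {I : ModelWithCorners ℝ E H}
  {M : Type*} [TopologicalSpace M] [ChartedSpace H M]

/-- The curve through `x` which is affine with velocity `v` in the preferred chart at `x`. -/
def chartLine (I : ModelWithCorners ℝ E H) (x : M) (v : E) (t : ℝ) : M :=
  (extChartAt I x).symm (extChartAt I x x + t • v)

@[simp] theorem chartLine_zero (x : M) (v : E) : chartLine I x v 0 = x := by
  rw [chartLine, zero_smul, add_zero, extChartAt_to_inv]

theorem continuousAt_chartLine (x : M) (v : E) : ContinuousAt (chartLine I x v) 0 := by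
  refine ContinuousAt.comp (f := fun t : ℝ => extChartAt I x x + t • v) ?_ (by fun_prop)
  rw [zero_smul, add_zero]
  exact continuousAt_extChartAt_symm (I := I) x

theorem symmL_trivializationAt_self_apply [IsManifold I 1 M] (x : M) (v : E) :
    (trivializationAt E (TangentSpace I) x).symmL ℝ x v = (id v : E) := by
  rw [TangentBundle.symmL_trivializationAt_eq_core (by simp)]
  exact (tangentBundleCore I M).coordChange_self (achart H x) x (mem_chart_source H x) v

/-- At an interior point the range of the model is a neighbourhood of the image of `x`, so the
derivative within the range, which defines `mvfderiv`, is a full derivative and may be tested along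
a line in both directions. -/
theorem hasDerivAt_comp_chartLine [IsManifold I 1 M] {u : M → ℝ} {x : M} (hx : I.IsInteriorPoint x)
    (hu : MDifferentiableAt I 𝓘(ℝ, ℝ) u x) (v : E) :
    HasDerivAt (fun t => u (chartLine I x v t))
      (mvfderiv I u x ((trivializationAt E (TangentSpace I) x).symmL ℝ x v)) 0 := by
  have h1 : HasFDerivAt (u ∘ (extChartAt I x).symm) (mvfderiv I u x : E →L[ℝ] ℝ)
      (extChartAt I x x) := by
    have h2 : DifferentiableWithinAt ℝ (writtenInExtChartAt I 𝓘(ℝ, ℝ) x u) (range I)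
        (extChartAt I x x) := hu.differentiableWithinAt_writtenInExtChartAt
    rw [hu.mvfderiv]
    exact h2.hasFDerivWithinAt.hasFDerivAt (range_mem_nhds_isInteriorPoint hx)
  have h3 : HasDerivAt (fun t : ℝ => extChartAt I x x + t • v) v 0 := by
    simpa using ((hasDerivAt_id (0:ℝ)).smul_const v).const_add (extChartAt I x x)
  have h1' : HasFDerivAt (u ∘ (extChartAt I x).symm) (mvfderiv I u x : E →L[ℝ] ℝ)
      (extChartAt I x x + (0 : ℝ) • v) := by rwa [zero_smul, add_zero]
  rw [symmL_trivializationAt_self_apply]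
  exact h1'.comp_hasDerivAt 0 h3

theorem mvfderiv_eq_zero_of_isLocalMin [IsManifold I 1 M] {u : M → ℝ} {x : M}
    (hx : I.IsInteriorPoint x)
    (hu : MDifferentiableAt I 𝓘(ℝ, ℝ) u x) (h : IsLocalMin u x) (v : TangentSpace I x) :
    mvfderiv I u x v = 0 := by
  have hd := hasDerivAt_comp_chartLine hx hu
    ((trivializationAt E (TangentSpace I) x).continuousLinearMapAt ℝ x v)
  rw [Trivialization.symmL_continuousLinearMapAt _
    (FiberBundle.mem_baseSet_trivializationAt' x)] at hd
  refine IsLocalMin.hasDerivAt_eq_zero ?_ hd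
  have := (continuousAt_chartLine (I := I) x 
    ((trivializationAt E (TangentSpace I) x).continuousLinearMapAt ℝ x v)).tendsto
  rw [chartLine_zero] at this
  filter_upwards [this h] with t ht
  rw [chartLine_zero]
  exact ht
end Interior

/-! ### Riemannian distance along chart lines. -/

section Riem
open scoped NNReal ENNReal
open MeasureTheory
variable {E : Type*} [NormedAddCommGroup E] [NormedSpace ℝ E]
  {H : Type*} [TopologicalSpace H] {I : ModelWithCorners ℝ E H}
  {M : Type*} [MetricSpace M] [ChartedSpace H M]
  [IsManifold I 1 M] [RiemannianBundle (fun x : M => TangentSpace I x)]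
  [IsContinuousRiemannianBundle E (fun x : M => TangentSpace I x)]

/-- The distance is at most the length of the chart line. Its speed is the norm of the constant
vector `v` read in nearby fibres, hence at most `r` times the norm at `x`. -/
theorem eventually_dist_chartLine_le [IsRiemannianManifold I M] {x : M} (hx : I.IsInteriorPoint x)
    (v : E) {r : ℝ} (hr : 1 < r) :
    ∀ᶠ t in 𝓝[>] (0 : ℝ), dist x (chartLine I x v t) ≤
      r * ‖(trivializationAt E (TangentSpace I) x).symmL ℝ x v‖ * t := by
  set φ := extChartAt I x with hφ
  set N := ‖(trivializationAt E (TangentSpace I) x).symmL ℝ x v‖ with hN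
  have hN0 : 0 ≤ N := norm_nonneg _
  have e1 : ∀ᶠ y in 𝓝 x, ‖(trivializationAt E (TangentSpace I) x).symmL ℝ y v‖ ≤ r * N := by
    filter_upwards [eventually_norm_symmL_trivializationAt_comp_self_lt E
      (fun x : M => TangentSpace I x) x hr] with y hy
    have := ContinuousLinearMap.le_of_opNorm_le _ hy.le 
      ((trivializationAt E (TangentSpace I) x).symmL ℝ x v)
    rwa [ContinuousLinearMap.comp_apply, Trivialization.continuousLinearMapAt_symmL _
      (FiberBundle.mem_baseSet_trivializationAt' x)] at this
  have hsymm : Tendsto φ.symm (𝓝 (φ x)) (𝓝 x) := by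
    have := (continuousAt_extChartAt_symm (I := I) x).tendsto
    rwa [extChartAt_to_inv] at this
  have htgt : φ.target ∈ 𝓝 (φ x) := by
    have := extChartAt_target_mem_nhdsWithin (I := I) x
    rwa [nhdsWithin_eq_nhds.2 (range_mem_nhds_isInteriorPoint hx)] at this
  obtain ⟨ρ, hρ, hball⟩ := Metric.mem_nhds_iff.1 (inter_mem (hsymm e1) htgt)
  have hη : Continuous (fun t : ℝ => φ x + t • v) := by fun_prop
  have e2 : ∀ᶠ t in 𝓝 (0 : ℝ), φ x + t • v ∈ Metric.ball (φ x) ρ := by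
    apply hη.continuousAt
    simpa using Metric.ball_mem_nhds (φ x) hρ
  filter_upwards [nhdsWithin_le_nhds e2, self_mem_nhdsWithin] with t ht htpos
  have htpos : 0 < t := htpos
  set η : ℝ → E := fun t : ℝ => φ x + t • v with hηdef
  have hηball : ∀ s ∈ Icc 0 t, η s ∈ Metric.ball (φ x) ρ := by
    intro s hs
    simp only [hηdef, mem_ball_iff_norm, add_sub_cancel_left, norm_smul] at ht ⊢
    refine lt_of_le_of_lt ?_ ht
    gcongr
    rw [Real.norm_of_nonneg hs.1, Real.norm_of_nonneg htpos.le]; exact hs.2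
  have η_smooth : ContMDiffOn 𝓘(ℝ, ℝ) 𝓘(ℝ, E) 1 η (Icc 0 t) := by
    apply ContMDiff.contMDiffOn
    rw [contMDiff_iff_contDiff]
    fun_prop
  have hmaps : Icc 0 t ⊆ η ⁻¹' φ.target := fun s hs => (hball (hηball s hs)).2
  have hγ : chartLine I x v = φ.symm ∘ η := rfl
  have hle : riemannianEDist I x (chartLine I x v t) ≤ pathELength I (chartLine I x v) 0 t := by
    apply riemannianEDist_le_pathELength _ (chartLine_zero x v) rfl htpos.le
    exact (contMDiffOn_extChartAt_symm x).comp η_smooth hmaps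
  have hlen : pathELength I (chartLine I x v) 0 t ≤
      ENNReal.ofReal (r * N) * ENNReal.ofReal t := by
    rw [pathELength_eq_lintegral_mfderivWithin_Icc]
    calc _ ≤ ∫⁻ s in Icc 0 t, ENNReal.ofReal (r * N) := ?_
      _ = _ := by simp
    apply setLIntegral_mono' measurableSet_Icc (fun s hs ↦ ?_)
    have h1 : mfderivWithin 𝓘(ℝ, ℝ) I (chartLine I x v) (Icc 0 t) s =
        (mfderivWithin 𝓘(ℝ, E) I φ.symm (range I) (η s)) ∘L
          (mfderivWithin 𝓘(ℝ, ℝ) 𝓘(ℝ, E) η (Icc 0 t) s) := by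
      apply mfderivWithin_comp
      · exact mdifferentiableWithinAt_extChartAt_symm (hmaps hs)
      · exact η_smooth.mdifferentiableOn one_ne_zero s hs
      · exact hmaps.trans (preimage_mono (extChartAt_target_subset_range x))
      · rw [uniqueMDiffWithinAt_iff_uniqueDiffWithinAt]
        exact uniqueDiffOn_Icc htpos s hs
    have h2 : mfderivWithin 𝓘(ℝ, ℝ) 𝓘(ℝ, E) η (Icc 0 t) s (1:ℝ) = v := by
      rw [mfderivWithin_eq_fderivWithin]
      have : HasDerivAt (fun t : ℝ => φ x + t • v) v s := by
        simpa using ((hasDerivAt_id s).smul_const v).const_add (φ x)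
      have h4 := this.hasDerivWithinAt.derivWithin (uniqueDiffOn_Icc htpos s hs)
      rw [derivWithin] at h4
      exact h4
    have hsrc : φ.symm (η s) ∈ (chartAt H x).source := by
      have := φ.map_target (hmaps hs)
      rwa [hφ, extChartAt_source] at this
    have h5 := TangentBundle.symmL_trivializationAt (I := I) hsrc
    rw [← hφ, φ.right_inv (hmaps hs)] at h5
    have h6 : mfderivWithin 𝓘(ℝ, ℝ) I (chartLine I x v) (Icc 0 t) s (1 : ℝ) =
        (trivializationAt E (TangentSpace I) x).symmL ℝ (φ.symm (η s)) v := by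
      rw [h1, h5]
      exact congrArg _ h2
    have h7 := (hball (hηball s hs)).1
    refine (le_of_eq (congrArg (fun w : TangentSpace I (φ.symm (η s)) => ‖w‖ₑ) h6)).trans ?_
    rw [← ofReal_norm]
    exact ENNReal.ofReal_le_ofReal h7
  have h3 := hle.trans hlen
  rw [← IsRiemannianManifold.out, edist_dist, ← ENNReal.ofReal_mul (by positivity)] at h3
  exact (ENNReal.ofReal_le_ofReal_iff (by positivity)).1 h3
end Riem

/-! ### The distance to a set has gradient of norm one where it is positive and smooth. -/

section Eikonal
open scoped NNReal ENNReal
open MeasureTheory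
variable {E : Type*} [NormedAddCommGroup E] [NormedSpace ℝ E]
  {H : Type*} [TopologicalSpace H] {I : ModelWithCorners ℝ E H}
  {M : Type*} [MetricSpace M] [ChartedSpace H M]
  [RiemannianBundle (fun x : M => TangentSpace I x)]

/-- Along a path that stays where `‖du‖ ≤ c`, the function `u` varies by at most `c` times the
length of the path. -/
theorem ofReal_sub_le_mul_pathELength {u : M → ℝ} {c : ℝ≥0} {γ : ℝ → M} {a b : ℝ} (hab : a ≤ b)
    (hγ : ContMDiffOn 𝓘(ℝ, ℝ) I 1 γ (Icc a b))
    (hu : ∀ t ∈ Icc a b, ContMDiffAt I 𝓘(ℝ, ℝ) 1 u (γ t))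
    (hc : ∀ t ∈ Icc a b, ∀ v, |mvfderiv I u (γ t) v| ≤ c * ‖v‖) :
    ENNReal.ofReal (u (γ a) - u (γ b)) ≤ c * pathELength I γ a b := by
  have hh : ContMDiffOn 𝓘(ℝ, ℝ) 𝓘(ℝ, ℝ) 1 (u ∘ γ) (Icc a b) := fun t ht =>
    (hu t ht).comp_contMDiffWithinAt t (hγ t ht)
  -- The real line is itself a Riemannian manifold, so the variation of `u` along `γ` is at most the
  -- length of `u ∘ γ`.
  have h1 : edist (u (γ a)) (u (γ b)) ≤ pathELength 𝓘(ℝ, ℝ) (u ∘ γ) a b := by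
    rw [IsRiemannianManifold.out (I := 𝓘(ℝ, ℝ)) (u (γ a)) (u (γ b))]
    exact riemannianEDist_le_pathELength hh rfl rfl hab
  have h2 : pathELength 𝓘(ℝ, ℝ) (u ∘ γ) a b ≤ c * pathELength I γ a b := by
    rw [pathELength_eq_lintegral_mfderiv_Ioo, pathELength_eq_lintegral_mfderiv_Ioo,
      ← lintegral_const_mul' _ _ ENNReal.coe_ne_top]
    apply setLIntegral_mono' measurableSet_Ioo (fun t ht ↦ ?_)
    have ht' := Ioo_subset_Icc_self ht
    have key : ∀ e : TangentSpace 𝓘(ℝ, ℝ) t, ‖mfderiv 𝓘(ℝ, ℝ) 𝓘(ℝ, ℝ) (u ∘ γ) t e‖ₑ ≤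
        c * ‖mfderiv 𝓘(ℝ, ℝ) I γ t e‖ₑ := by
      intro e
      have h3 : mvfderiv I u (γ t) (mfderiv 𝓘(ℝ, ℝ) I γ t e) =
          mfderiv 𝓘(ℝ, ℝ) 𝓘(ℝ, ℝ) (u ∘ γ) t e :=
        (mfderiv_comp_apply t ((hu t ht').mdifferentiableAt one_ne_zero)
          (((hγ t ht').contMDiffAt (Icc_mem_nhds ht.1 ht.2)).mdifferentiableAt one_ne_zero)
          e).symm
      have h5 := hc t ht' (mfderiv 𝓘(ℝ, ℝ) I γ t e)
      have h6 : ‖mfderiv 𝓘(ℝ, ℝ) 𝓘(ℝ, ℝ) (u ∘ γ) t e‖ₑ =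
          ENNReal.ofReal |mvfderiv I u (γ t) (mfderiv 𝓘(ℝ, ℝ) I γ t e)| := by
        rw [h3, enorm_tangentSpace_vectorSpace]
        exact Real.enorm_eq_ofReal_abs _
      rw [h6, ← ofReal_norm, ← ENNReal.ofReal_coe_nnreal, ← ENNReal.ofReal_mul c.coe_nonneg]
      exact ENNReal.ofReal_le_ofReal h5
    exact key _
  calc _ ≤ edist (u (γ a)) (u (γ b)) := by
        rw [edist_dist]; exact ENNReal.ofReal_le_ofReal (le_abs_self _)
    _ ≤ _ := h1.trans h2

variable [IsManifold I 1 M] [IsContinuousRiemannianBundle E (fun x : M => TangentSpace I x)]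
  [IsRiemannianManifold I M]

theorem mvfderiv_apply_le_norm {u : M → ℝ} (hLip : ∀ x y, u y - u x ≤ dist x y) {x : M}
    (hx : I.IsInteriorPoint x) (hu : MDifferentiableAt I 𝓘(ℝ, ℝ) u x) (v : TangentSpace I x) :
    mvfderiv I u x v ≤ ‖v‖ := by
  -- Chart lines are only almost length-minimizing, hence the slack `r > 1`, removed at the end.
  have key : ∀ r : ℝ, 1 < r → mvfderiv I u x v ≤ r * ‖v‖ := by
    intro r hr
    set w := (trivializationAt E (TangentSpace I) x).continuousLinearMapAt ℝ x v
    have hw : (trivializationAt E (TangentSpace I) x).symmL ℝ x w = v :=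
      Trivialization.symmL_continuousLinearMapAt _ (FiberBundle.mem_baseSet_trivializationAt' x) _
    have hd := hasDerivAt_comp_chartLine hx hu w
    have hl := eventually_dist_chartLine_le hx w hr
    rw [hw] at hd hl
    refine le_of_tendsto hd.tendsto_slope_zero_right ?_
    filter_upwards [hl, self_mem_nhdsWithin] with t ht htpos
    have htpos : 0 < t := htpos
    have := (hLip x (chartLine I x w t)).trans ht
    rw [zero_add, chartLine_zero, smul_eq_mul, inv_mul_le_iff₀ htpos]
    linarith
  refine le_of_forall_pos_le_add fun ε hε => ?_
  have h1 := key (1 + ε / (‖v‖ + 1)) (by linarith [show 0 < ε / (‖v‖ + 1) by positivity])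
  have h2 : ε / (‖v‖ + 1) * ‖v‖ ≤ ε := by
    rw [div_mul_eq_mul_div, div_le_iff₀ (by positivity)]
    nlinarith [norm_nonneg v]
  linarith

/-- If `‖du‖ < c < 1` near `x`, a nearly shortest curve from `x` to `S` wastes length: until it
leaves the ball of radius `ρ` it lowers `u` by at most `c` times its length. No minimizing geodesic
is needed. -/
theorem norm_le_mvfderiv_of_infDist {S : Set M} (hS : S.Nonempty) {x : M}
    (hxS : 0 < Metric.infDist x S) 
    (hu : ∀ᶠ y in 𝓝 x, ContMDiffAt I 𝓘(ℝ, ℝ) 1 (fun y => Metric.infDist y S) y) :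
    1 ≤ ‖mvfderiv I (fun y => Metric.infDist y S) x‖ := by
  set u : M → ℝ := fun y => Metric.infDist y S with hudef
  by_contra! hlt
  obtain ⟨c, hc1, hc2⟩ := exists_between hlt
  have hc0 : 0 ≤ c := (ContinuousLinearMap.opNorm_nonneg _).trans hc1.le
  obtain ⟨ρ₀, hρ₀, hball⟩ := Metric.mem_nhds_iff.1 
    (inter_mem hu (eventually_norm_mvfderiv_lt hu.self_of_nhds hc1))
  set ρ := min (ρ₀ / 2) (u x / 2)
  have hρ : 0 < ρ := lt_min (by positivity) (half_pos hxS)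
  have hρ1 : ρ < ρ₀ := (min_le_left _ _).trans_lt (by linarith)
  have hρ2 : ρ < u x := (min_le_right _ _).trans_lt (half_lt_self hxS)
  -- The excess `(1 - c) * ρ` is exactly the length that the first piece of the curve, of length at
  -- least `ρ`, must waste.
  obtain ⟨z, hz, hxz⟩ := (Metric.infDist_lt_iff hS).1
    (show u x < u x + (1 - c) * ρ by nlinarith)
  have hr : riemannianEDist I x z < ENNReal.ofReal (u x + (1 - c) * ρ) := by
    rw [← IsRiemannianManifold.out, edist_dist]
    exact (ENNReal.ofReal_lt_ofReal_iff (by nlinarith)).2 hxz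
  obtain ⟨γ, hγ0, hγ1, hγ, hlen⟩ := exists_lt_of_riemannianEDist_lt hr
  have hcont : ContinuousOn (fun t => dist x (γ t)) (Icc 0 1) :=
    (continuous_const.dist continuous_id).comp_continuousOn hγ.continuousOn
  -- first time at distance `ρ` from `x`
  set A := Icc (0:ℝ) 1 ∩ (fun t => dist x (γ t)) ⁻¹' {ρ}
  have hA : IsCompact A := by
    refine isCompact_Icc.of_isClosed_subset ?_ inter_subset_left
    exact hcont.preimage_isClosed_of_isClosed isClosed_Icc isClosed_singleton
  have hAne : A.Nonempty := by
    have := intermediate_value_Icc zero_le_one hcont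
    obtain ⟨t, ht, ht'⟩ := this (show ρ ∈ Icc (dist x (γ 0)) (dist x (γ 1)) by
      rw [hγ0, hγ1, dist_self]
      exact ⟨hρ.le, hρ2.le.trans (Metric.infDist_le_dist_of_mem hz)⟩)
    exact ⟨t, ht, ht'⟩
  obtain ⟨s, ⟨hs, hsρ⟩, hsmin⟩ := hA.exists_isLeast hAne
  have hsρ : dist x (γ s) = ρ := hsρ
  have hin : ∀ t ∈ Icc 0 s, dist x (γ t) ≤ ρ := by
    intro t ht
    by_contra! hgt
    have hsub : Icc 0 t ⊆ Icc (0:ℝ) 1 := Icc_subset_Icc_right (ht.2.trans hs.2)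
    obtain ⟨t', ht', ht'2⟩ := intermediate_value_Icc ht.1 (hcont.mono hsub)
      (show ρ ∈ Icc (dist x (γ 0)) (dist x (γ t)) by
        rw [hγ0, dist_self]; exact ⟨hρ.le, hgt.le⟩)
    have h1 : s ≤ t' := hsmin ⟨hsub ht', ht'2⟩
    have h2 : t = s := le_antisymm ht.2 (h1.trans ht'.2)
    rw [h2, hsρ] at hgt
    exact lt_irrefl _ hgt
  have hsub1 : Icc 0 s ⊆ Icc (0:ℝ) 1 := Icc_subset_Icc_right hs.2
  have hsub2 : Icc s 1 ⊆ Icc (0:ℝ) 1 := Icc_subset_Icc_left hs.1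
  have hg : ∀ t ∈ Icc 0 s, γ t ∈ Metric.ball x ρ₀ := fun t ht =>
    Metric.mem_ball'.2 ((hin t ht).trans_lt hρ1)
  lift c to ℝ≥0 using hc0
  have b1 := ofReal_sub_le_mul_pathELength (u := u) (c := c) hs.1 (hγ.mono hsub1)
    (fun t ht => (hball (hg t ht)).1)
    (fun t ht v => ContinuousLinearMap.le_of_opNorm_le _ (le_of_lt (hball (hg t ht)).2) v)
  have b2 : ENNReal.ofReal ρ ≤ pathELength I γ 0 s := by
    rw [← hsρ, ← edist_dist, IsRiemannianManifold.out (I := I), ← hγ0]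
    exact riemannianEDist_le_pathELength (hγ.mono hsub1) rfl rfl hs.1
  have b3 : ENNReal.ofReal (u (γ s)) ≤ pathELength I γ s 1 := by
    have : u (γ s) ≤ dist (γ s) z := Metric.infDist_le_dist_of_mem hz
    refine (ENNReal.ofReal_le_ofReal this).trans ?_
    rw [← edist_dist, IsRiemannianManifold.out (I := I), ← hγ1]
    exact riemannianEDist_le_pathELength (hγ.mono hsub2) rfl rfl hs.2
  rw [← pathELength_add hs.1 hs.2] at hlen
  have f1 : pathELength I γ 0 s ≠ ⊤ := ((le_self_add).trans_lt hlen).ne_top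
  have f2 : pathELength I γ s 1 ≠ ⊤ := ((le_add_self).trans_lt hlen).ne_top
  generalize pathELength I γ 0 s = L1 at *
  generalize pathELength I γ s 1 = L2 at *
  lift L1 to ℝ≥0 using f1
  lift L2 to ℝ≥0 using f2
  rw [hγ0] at b1
  rw [← ENNReal.coe_mul, ENNReal.ofReal_le_coe] at b1
  rw [ENNReal.ofReal_le_coe] at b2 b3
  rw [← ENNReal.coe_add, ENNReal.lt_ofReal_iff_toReal_lt ENNReal.coe_ne_top,
    ENNReal.coe_toReal, NNReal.coe_add] at hlen
  rw [NNReal.coe_mul] at b1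
  -- `u x ≤ c L1 + L2 = (L1 + L2) - (1 - c) L1 < u x + (1 - c) ρ - (1 - c) L1 ≤ u x`.
  nlinarith
end Eikonal

/-! ### Basis independence of the metric trace and its splitting along a unit normal. -/

section Trace
variable {V : Type*} [NormedAddCommGroup V] [InnerProductSpace ℝ V] [FiniteDimensional ℝ V]

/-- Expand the standard basis in `e`; Parseval collapses the double sum to its diagonal. -/
theorem trace_eq_sum {ι : Type*} [Fintype ι] (B : V →ₗ[ℝ] V →ₗ[ℝ] ℝ) (e : OrthonormalBasis ι ℝ V) :
    trace (fun v w => B v w) = ∑ i, B (e i) (e i) := by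
  classical
  unfold trace
  set f := stdOrthonormalBasis ℝ V
  calc ∑ j, B (f j) (f j)
      = ∑ j, ∑ i, ∑ k, (inner ℝ (e i) (f j) * inner ℝ (f j) (e k)) * B (e i) (e k) := by
        refine Finset.sum_congr rfl fun j _ => ?_
        conv_lhs => rw [← e.sum_repr' (f j)]
        simp only [map_sum, LinearMap.sum_apply, map_smul, LinearMap.smul_apply, smul_eq_mul,
          real_inner_comm (e _) (f j), Finset.mul_sum, mul_assoc]
        rw [Finset.sum_comm]
        exact Finset.sum_congr rfl fun i _ => Finset.sum_congr rfl fun k _ => by ring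
    _ = ∑ i, ∑ k, inner ℝ (e i) (e k) * B (e i) (e k) := by
        rw [Finset.sum_comm]
        refine Finset.sum_congr rfl fun i _ => ?_
        rw [Finset.sum_comm]
        refine Finset.sum_congr rfl fun k _ => ?_
        rw [← Finset.sum_mul, f.sum_inner_mul_inner]
    _ = ∑ i, B (e i) (e i) := by
        simp [orthonormal_iff_ite.1 e.orthonormal, ite_mul]

/-- `n` together with an orthonormal basis of its orthogonal complement `W` is an orthonormal basis,
indexed here by `Option`. -/
theorem trace_eq_trace_add_apply (B : V →ₗ[ℝ] V →ₗ[ℝ] ℝ) {n : V} (hn : ‖n‖ = 1)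
    (W : Submodule ℝ V) (hW : ∀ v, v ∈ W ↔ inner ℝ n v = 0) :
    trace (fun v w => B v w) = trace (V := W) (fun v w => B v w) + B n n := by
  set f := stdOrthonormalBasis ℝ W
  set e : Option (Fin (Module.finrank ℝ W)) → V := fun o => o.elim n (fun i => (f i : V))
  have he : Orthonormal ℝ e := by
    classical
    rw [orthonormal_iff_ite]
    have hf := orthonormal_iff_ite.1 f.orthonormal
    rintro (_ | i) (_ | j)
    · simp [e, hn]
    · simpa [e] using (hW _).1 (f j).2
    · simpa [e] using (real_inner_comm _ _).trans ((hW _).1 (f i).2)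
    · simpa [e] using hf i j
  have hspan : ⊤ ≤ Submodule.span ℝ (range e) := by
    intro v _
    have hn' : n ∈ Submodule.span ℝ (range e) := Submodule.subset_span ⟨none, rfl⟩
    have hWs : ∀ w ∈ W, w ∈ Submodule.span ℝ (range e) := by
      intro w hw
      have := congrArg (Subtype.val) (f.sum_repr ⟨w, hw⟩)
      rw [← show _ = w from this]
      simp only [Submodule.coe_sum, Submodule.coe_smul]
      exact Submodule.sum_mem _ fun i _ => Submodule.smul_mem _ _
        (Submodule.subset_span ⟨some i, rfl⟩)
    have hv : v = (v - inner ℝ n v • n) + inner ℝ n v • n := by abel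
    rw [hv]
    refine Submodule.add_mem _ (hWs _ ?_) (Submodule.smul_mem _ _ hn')
    rw [hW, inner_sub_right, inner_smul_right, real_inner_self_eq_norm_sq, hn]
    ring
  rw [trace_eq_sum B (OrthonormalBasis.mk he hspan)]
  simp only [OrthonormalBasis.coe_mk, Fintype.sum_option]
  rw [add_comm]
  rfl
end Trace

theorem isContinuousRiemannianBundle_of_contMDiff
    {EB : Type*} [NormedAddCommGroup EB] [NormedSpace ℝ EB]
    {HB : Type*} [TopologicalSpace HB] (IB : ModelWithCorners ℝ EB HB) (n : WithTop ℕ∞)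
    {B : Type*} [TopologicalSpace B] [ChartedSpace HB B]
    (F : Type*) [NormedAddCommGroup F] [NormedSpace ℝ F]
    (V : B → Type*) [TopologicalSpace (TotalSpace F V)] [∀ x, NormedAddCommGroup (V x)]
    [∀ x, InnerProductSpace ℝ (V x)] [FiberBundle F V] [VectorBundle ℝ F V]
    [IsContMDiffRiemannianBundle IB n F V] : IsContinuousRiemannianBundle F V := by
  obtain ⟨g, hg, h⟩ := IsContMDiffRiemannianBundle.exists_contMDiff (IB := IB) (n := n) (F := F)
    (E := V)
  exact ⟨g, hg.continuous, h⟩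

/-! ### Bilinearity of the covariant Hessian and its chain rule. -/

section Hessian

variable {M : Type*} [TopologicalSpace M] [ChartedSpace (EuclideanHalfSpace 3) M]
  [IsManifold 𝕀 ∞ M]

theorem coordField_apply_self (x : M) (v : 𝕋 x) : coordField x v x = v :=
  FiberBundle.extend_apply_self _ v

theorem coordField_eq_symmL (x : M) (v : 𝕋 x) {y : M}
    (hy : y ∈ (trivializationAt (EuclideanSpace ℝ (Fin 3)) (TangentSpace 𝕀 : M → Type _) x).baseSet) :
    coordField x v y = 
      (trivializationAt (EuclideanSpace ℝ (Fin 3)) (TangentSpace 𝕀 : M → Type _) x).symmL ℝ y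
      ((trivializationAt (EuclideanSpace ℝ (Fin 3)) (TangentSpace 𝕀 : M → Type _) x).continuousLinearMapAt ℝ x v) := by
  rw [Trivialization.symmL_apply _ hy, Trivialization.continuousLinearMapAt_apply,
    Trivialization.coe_linearMapAt_of_mem _ (FiberBundle.mem_baseSet_trivializationAt' x)]
  rfl

theorem eventually_mem_baseSet (x : M) : ∀ᶠ y in 𝓝 x, 
  y ∈ (trivializationAt (EuclideanSpace ℝ (Fin 3)) (TangentSpace 𝕀 : M → Type _) x).baseSet :=
  (Trivialization.open_baseSet (trivializationAt (EuclideanSpace ℝ (Fin 3))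
    (TangentSpace 𝕀 : M → Type _) x)).mem_nhds (FiberBundle.mem_baseSet_trivializationAt' x)

/-- Linearity in the vector is obtained on the base set of the trivialization; this neighbourhood of
`x` suffices because the fields are only differentiated at `x`. -/
theorem eventually_coordField_add (x : M) (v w : 𝕋 x) :
    ∀ᶠ y in 𝓝 x, coordField x (v + w) y = coordField x v y + coordField x w y := by
  filter_upwards [eventually_mem_baseSet x] with y hy
  simp only [coordField_eq_symmL x _ hy, map_add]

theorem eventually_coordField_smul (x : M) (c : ℝ) (v : 𝕋 x) :
    ∀ᶠ y in 𝓝 x, coordField x (c • v) y = c • coordField x v y := by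
  filter_upwards [eventually_mem_baseSet x] with y hy
  simp only [coordField_eq_symmL x _ hy, map_smul]

theorem mdifferentiableAt_diff_coordField {u : M → ℝ} {x : M} (hu : ContMDiffAt 𝕀 𝓘(ℝ, ℝ) 2 u x)
    (w : 𝕋 x) : MDifferentiableAt 𝕀 𝓘(ℝ, ℝ) (fun y => diff u y (coordField x w y)) x := by
  have h := contMDiffAt_mvfderiv_comp_symmL (m := 1) hu (by norm_num)
  have h2 := ((h.clm_apply (contMDiffAt_const (c := (trivializationAt (EuclideanSpace ℝ (Fin 3))
    (TangentSpace 𝕀 : M → Type _) x).continuousLinearMapAt ℝ x w))).mdifferentiableAt one_ne_zero)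
  refine h2.congr_of_eventuallyEq ?_
  filter_upwards [eventually_mem_baseSet x] with y hy
  rw [coordField_eq_symmL x _ hy]
  rfl

omit [IsManifold 𝕀 ∞ M] in
theorem diff_congr {f g : M → ℝ} {x : M} (h : f =ᶠ[𝓝 x] g) : diff f x = diff g x := by
  ext v
  exact congrArg (fun L : EuclideanSpace ℝ (Fin 3) →L[ℝ] ℝ => L v) h.mfderiv_eq

omit [IsManifold 𝕀 ∞ M] in
theorem diff_comp {u : M → ℝ} {x : M} {ψ : ℝ → ℝ} (hψ : DifferentiableAt ℝ ψ (u x))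
    (hu : MDifferentiableAt 𝕀 𝓘(ℝ, ℝ) u x) :
    diff (fun y => ψ (u y)) x = deriv ψ (u x) • diff u x := by
  ext v
  have h : diff (ψ ∘ u) x v = fderiv ℝ ψ (u x) (diff u x v) := by
    rw [← mfderiv_eq_fderiv]
    exact mfderiv_comp_apply x hψ.mdifferentiableAt hu v
  refine h.trans ?_
  rw [fderiv_eq_smul_deriv, smul_eq_mul, mul_comm]
  rfl

theorem diff_coordField_add {u : M → ℝ} {x : M} (hu : ContMDiffAt 𝕀 𝓘(ℝ, ℝ) 2 u x) (w w' : 𝕋 x) :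
    diff (fun y => diff u y (coordField x (w + w') y)) x =
      diff (fun y => diff u y (coordField x w y)) x +
        diff (fun y => diff u y (coordField x w' y)) x := by
  rw [← mvfderiv_fun_add (mdifferentiableAt_diff_coordField hu w)
    (mdifferentiableAt_diff_coordField hu w')]
  refine diff_congr ?_
  filter_upwards [eventually_coordField_add x w w'] with y hy
  rw [hy, map_add]

theorem diff_coordField_smul {u : M → ℝ} {x : M} (hu : ContMDiffAt 𝕀 𝓘(ℝ, ℝ) 2 u x) (c : ℝ)
    (w : 𝕋 x) :
    diff (fun y => diff u y (coordField x (c • w) y)) x =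
      c • diff (fun y => diff u y (coordField x w y)) x := by
  have h : diff (fun y => diff u y (coordField x (c • w) y)) x =
      diff (fun y => c * diff u y (coordField x w y)) x := by
    refine diff_congr ?_
    filter_upwards [eventually_coordField_smul x c w] with y hy
    rw [hy, map_smul, smul_eq_mul]
  rw [h, diff, mvfderiv_fun_mul mdifferentiableAt_const (mdifferentiableAt_diff_coordField hu w),
    mvfderiv_const, smul_zero, add_zero]

variable [RiemannianBundle (fun x : M => 𝕋 x)]

omit [IsManifold 𝕀 ∞ M] in
theorem diff_eq_inner_grad (u : M → ℝ) (x : M) (v : 𝕋 x) : diff u x v = inner ℝ (grad u x) v := by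
  rw [grad, InnerProductSpace.toDual_symm_apply]

omit [IsManifold 𝕀 ∞ M] in
theorem norm_grad (u : M → ℝ) (x : M) : ‖grad u x‖ = ‖diff u x‖ := by
  rw [grad, LinearIsometryEquiv.norm_map]

omit [IsManifold 𝕀 ∞ M] in
theorem grad_comp {u : M → ℝ} {x : M} {ψ : ℝ → ℝ} (hψ : DifferentiableAt ℝ ψ (u x))
    (hu : MDifferentiableAt 𝕀 𝓘(ℝ, ℝ) u x) :
    grad (fun y => ψ (u y)) x = deriv ψ (u x) • grad u x := by
  rw [grad, grad, diff_comp hψ hu, map_smulₛₗ]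
  rfl

/-- The derivative at `x` of the inner product of two coordinate fields. -/
def metricDeriv (x : M) (v w : 𝕋 x) : 𝕋 x →L[ℝ] ℝ :=
  diff (fun y => inner ℝ (coordField x v y) (coordField x w y)) x

theorem christoffel_eq (x : M) (u v w : 𝕋 x) :
    christoffel x u v w = (metricDeriv x v w u + metricDeriv x u w v - metricDeriv x u v w) / 2 :=
  rfl

theorem metricDeriv_comm (x : M) (v w : 𝕋 x) : metricDeriv x v w = metricDeriv x w v := by
  unfold metricDeriv
  congr 1
  ext y
  exact real_inner_comm _ _

variable [IsContMDiffRiemannianBundle 𝕀 ∞ (EuclideanSpace ℝ (Fin 3)) (fun x : M => 𝕋 x)]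

theorem mdifferentiableAt_inner_coordField (x : M) (v w : 𝕋 x) :
    MDifferentiableAt 𝕀 𝓘(ℝ, ℝ) (fun y => inner ℝ (coordField x v y) (coordField x w y)) x :=
  haveI : IsContMDiffRiemannianBundle 𝕀 1 (EuclideanSpace ℝ (Fin 3)) (fun x : M => 𝕋 x) :=
    IsContMDiffRiemannianBundle.of_le (n := ∞) (by simp)
  MDifferentiableAt.inner_bundle (F := EuclideanSpace ℝ (Fin 3)) (E := fun x : M => 𝕋 x)
     (FiberBundle.mdifferentiableAt_extend ..) (FiberBundle.mdifferentiableAt_extend ..)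

theorem metricDeriv_add_left (x : M) (v v' w : 𝕋 x) :
    metricDeriv x (v + v') w = metricDeriv x v w + metricDeriv x v' w := by
  unfold metricDeriv
  rw [← mvfderiv_fun_add (mdifferentiableAt_inner_coordField x v w)
    (mdifferentiableAt_inner_coordField x v' w)]
  refine diff_congr ?_
  filter_upwards [eventually_coordField_add x v v'] with y hy
  rw [hy, inner_add_left]

theorem metricDeriv_smul_left (x : M) (c : ℝ) (v w : 𝕋 x) :
    metricDeriv x (c • v) w = c • metricDeriv x v w := by
  have h : metricDeriv x (c • v) w =
      diff (fun y => c * inner ℝ (coordField x v y) (coordField x w y)) x := by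
    refine diff_congr ?_
    filter_upwards [eventually_coordField_smul x c v] with y hy
    rw [hy, real_inner_smul_left]
  rw [h, diff, mvfderiv_fun_mul mdifferentiableAt_const (mdifferentiableAt_inner_coordField x v w),
    mvfderiv_const, smul_zero, add_zero]
  rfl

theorem metricDeriv_add_right (x : M) (v w w' : 𝕋 x) :
    metricDeriv x v (w + w') = metricDeriv x v w + metricDeriv x v w' := by
  rw [metricDeriv_comm, metricDeriv_add_left, metricDeriv_comm x w, metricDeriv_comm x w']

theorem metricDeriv_smul_right (x : M) (c : ℝ) (v w : 𝕋 x) :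
    metricDeriv x v (c • w) = c • metricDeriv x v w := by
  rw [metricDeriv_comm, metricDeriv_smul_left, metricDeriv_comm x w]

theorem christoffel_smul_right (x : M) (c : ℝ) (u v w : 𝕋 x) :
    christoffel x u v (c • w) = c * christoffel x u v w := by
  simp only [christoffel_eq, metricDeriv_smul_right, map_smul, smul_apply,
    smul_eq_mul]
  ring

/-- The covariant Hessian as a bilinear map. -/
def hessianₗ {u : M → ℝ} {x : M} (hu : ContMDiffAt 𝕀 𝓘(ℝ, ℝ) 2 u x) : 𝕋 x →ₗ[ℝ] 𝕋 x →ₗ[ℝ] ℝ :=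
  LinearMap.mk₂ ℝ (hessian u x)
    (fun v v' w => by
      simp only [hessian, christoffel_eq, metricDeriv_add_left, map_add,
        add_apply]
      ring)
    (fun c v w => by
      simp only [hessian, christoffel_eq, metricDeriv_smul_left, map_smul,
        smul_apply, smul_eq_mul]
      ring)
    (fun v w w' => by
      simp only [hessian, christoffel_eq, metricDeriv_add_left, metricDeriv_add_right, map_add,
        add_apply, diff_coordField_add hu]
      ring)
    (fun c v w => by
      simp only [hessian, christoffel_eq, metricDeriv_smul_left, metricDeriv_smul_right, map_smul,
        smul_apply, smul_eq_mul, diff_coordField_smul hu]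
      ring)

theorem hessian_comp {u : M → ℝ} {x : M} (hu : ContMDiffAt 𝕀 𝓘(ℝ, ℝ) 2 u x) {ψ : ℝ → ℝ}
    (hψ : ContDiffAt ℝ 2 ψ (u x)) (v w : 𝕋 x) :
    hessian (fun y => ψ (u y)) x v w =
      deriv (deriv ψ) (u x) * diff u x v * diff u x w + deriv ψ (u x) * hessian u x v w := by
  have hu1 := hu.mdifferentiableAt two_ne_zero
  have hψ1 := hψ.differentiableAt two_ne_zero
  -- The first-order chain rule is needed on a whole neighbourhood, since it is differentiated once
  -- more.
  have hev : (fun y => diff (fun y => ψ (u y)) y (coordField x w y)) =ᶠ[𝓝 x]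
      fun y => deriv ψ (u y) * diff u y (coordField x w y) := by
    have e1 : ∀ᶠ y in 𝓝 x, ContMDiffAt 𝕀 𝓘(ℝ, ℝ) 2 u y := 
      (contMDiffAt_iff_contMDiffAt_nhds (by decide)).1 hu
    have e2 : ∀ᶠ y in 𝓝 x, ContDiffAt ℝ 2 ψ (u y) :=
      hu.continuousAt.eventually (hψ.eventually (by decide))
    filter_upwards [e1, e2] with y h1 h2
    rw [diff_comp (h2.differentiableAt two_ne_zero) (h1.mdifferentiableAt two_ne_zero)]
    rfl
  have hψ' : DifferentiableAt ℝ (deriv ψ) (u x) := by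
    have h1 : ContDiffAt ℝ 1 (fun t => fderiv ℝ ψ t 1) (u x) :=
      (hψ.fderiv_right (m := 1) (by norm_num)).clm_apply contDiffAt_const
    exact h1.differentiableAt one_ne_zero
  have hm : MDifferentiableAt 𝕀 𝓘(ℝ, ℝ) (fun y => deriv ψ (u y)) x :=
    hψ'.mdifferentiableAt.comp x hu1
  rw [hessian, hessian, grad_comp hψ1 hu1, christoffel_smul_right, diff_congr hev, diff,
    mvfderiv_fun_mul hm (mdifferentiableAt_diff_coordField hu w)]
  have h3 : mvfderiv 𝕀 (fun y => deriv ψ (u y)) x = deriv (deriv ψ) (u x) • diff u x :=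
    diff_comp hψ' hu1
  rw [h3]
  simp only [add_apply, smul_apply, smul_eq_mul,
    coordField_apply_self]
  ring

end Hessian

/-! ### The Jang operator on functions of a solution of the eikonal equation. -/

section Operator
variable {M : Type*} [TopologicalSpace M] [ChartedSpace (EuclideanHalfSpace 3) M]
  [IsManifold 𝕀 ∞ M] [RiemannianBundle (fun x : M => 𝕋 x)]
  [IsContMDiffRiemannianBundle 𝕀 ∞ (EuclideanSpace ℝ (Fin 3)) (fun x : M => 𝕋 x)]

/-- The Hessian of a solution of the eikonal equation annihilates its gradient. -/
theorem hessian_grad_grad_eq_zero {u : M → ℝ} {x : M} (hx : ModelWithCorners.IsInteriorPoint 𝕀 x)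
    (hu : ContMDiffAt 𝕀 𝓘(ℝ, ℝ) 2 u x) (h1 : ∀ᶠ y in 𝓝 x, ‖grad u y‖ = 1) :
    hessian u x (grad u x) (grad u x) = 0 := by
  set n := grad u x with hn
  set a : M → ℝ := fun y => diff u y (coordField x n y)
  set b : M → ℝ := fun y => inner ℝ (coordField x n y) (coordField x n y)
  have ha : MDifferentiableAt 𝕀 𝓘(ℝ, ℝ) a x := mdifferentiableAt_diff_coordField hu n
  have hb : MDifferentiableAt 𝕀 𝓘(ℝ, ℝ) b x := mdifferentiableAt_inner_coordField x n n
  have hnn : inner ℝ n n = 1 := by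
    rw [real_inner_self_eq_norm_sq, h1.self_of_nhds, one_pow]
  have ha2 : MDifferentiableAt 𝕀 𝓘(ℝ, ℝ) (fun y => a y + a y) x := ha.add ha
  have hab : MDifferentiableAt 𝕀 𝓘(ℝ, ℝ) (fun y => b y - (a y + a y)) x := hb.sub ha2
  -- `b - 2a + 1 = |∇u - V|²`, where `V` is the coordinate field extending `n`; this is nonnegative
  -- and vanishes at `x`. Differentiating it at its minimum replaces differentiating `|∇u|² = 1`
  -- covariantly.
  have hmin : IsLocalMin (fun y => b y - (a y + a y)) x := by
    filter_upwards [h1] with y hy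
    have e : ‖grad u y - coordField x n y‖ ^ 2 = 1 - 2 * a y + b y := by
      rw [norm_sub_sq_real, hy, one_pow, ← real_inner_self_eq_norm_sq, ← diff_eq_inner_grad]
    have hax : a x = 1 := by
      simp only [a, coordField_apply_self]
      rw [diff_eq_inner_grad]; exact hnn
    have hbx : b x = 1 := by
      simp only [b, coordField_apply_self]; exact hnn
    rw [hax, hbx]
    nlinarith [sq_nonneg ‖grad u y - coordField x n y‖]
  have h0 := mvfderiv_eq_zero_of_isLocalMin hx hab hmin n
  rw [mvfderiv_fun_sub hb ha2, mvfderiv_fun_add ha ha] at h0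
  -- With all three arguments equal to `n`, the Christoffel symbol reduces to half the derivative of
  -- `b`.
  have h2 : hessian u x n n = diff a x n - diff b x n / 2 := by
    rw [hessian, christoffel_eq, ← hn]
    simp only [metricDeriv, a, b]
    ring
  rw [h2]
  have h0' : diff b x n - (diff a x n + diff a x n) = 0 := h0
  linarith

/-- The tensor of the Jang operator as a bilinear map. -/
def jangTensorₗ (φ : M → ℝ) (k : ∀ x : M, 𝕋 x →L[ℝ] 𝕋 x →L[ℝ] ℝ) {f : M → ℝ} {x : M}
    (hf : ContMDiffAt 𝕀 𝓘(ℝ, ℝ) 2 f x) : 𝕋 x →ₗ[ℝ] 𝕋 x →ₗ[ℝ] ℝ :=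
  LinearMap.mk₂ ℝ (jangTensor φ k f x)
    (fun v v' w => by
      have := (hessianₗ hf).map_add₂ v v' w
      simp only [hessianₗ, LinearMap.mk₂_apply] at this
      simp only [jangTensor, this, map_add, add_apply]
      ring)
    (fun c v w => by
      have := (hessianₗ hf).map_smul₂ c v w
      simp only [hessianₗ, LinearMap.mk₂_apply] at this
      simp only [jangTensor, this, map_smul, smul_apply, smul_eq_mul]
      ring)
    (fun v w w' => by
      have := (hessianₗ hf v).map_add w w'
      simp only [hessianₗ, LinearMap.mk₂_apply] at this
      simp only [jangTensor, this, map_add]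
      ring)
    (fun c v w => by
      have := (hessianₗ hf v).map_smul c w
      simp only [hessianₗ, LinearMap.mk₂_apply] at this
      simp only [jangTensor, this, map_smul, smul_eq_mul]
      ring)

/-- The Jang operator of a function of the distance, in terms of the geometry of the level sets. -/
theorem jangOperator_comp (φ : M → ℝ) (k : ∀ x : M, 𝕋 x →L[ℝ] 𝕋 x →L[ℝ] ℝ) {u : M → ℝ} {x : M}
    (hx : ModelWithCorners.IsInteriorPoint 𝕀 x)
    (hu : ContMDiffAt 𝕀 𝓘(ℝ, ℝ) 2 u x) (h1 : ∀ᶠ y in 𝓝 x, ‖grad u y‖ = 1)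
    {ψ : ℝ → ℝ} (hψ : ContDiffAt ℝ 2 ψ (u x)) :
    jangOperator φ k (fun y => ψ (u y)) x =
      φ x * deriv ψ (u x) / √(1 + (φ x * deriv ψ (u x)) ^ 2) * levelMeanCurvature u x
      - trace (V := levelTangent u x) (fun v w => k x v w)
      + (1 + (φ x * deriv ψ (u x)) ^ 2)⁻¹ *
        ((φ x * deriv (deriv ψ) (u x) + 2 * diff φ x (grad u x) * deriv ψ (u x))
          / √(1 + (φ x * deriv ψ (u x)) ^ 2) - k x (grad u x) (grad u x)) := by
  have hu1 := hu.mdifferentiableAt two_ne_zero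
  have hψ1 := hψ.differentiableAt two_ne_zero
  have hf : ContMDiffAt 𝕀 𝓘(ℝ, ℝ) 2 (fun y => ψ (u y)) x := hψ.contMDiffAt.comp x hu
  have hnn : ‖grad u x‖ = 1 := h1.self_of_nhds
  set n := grad u x with hn
  set p := deriv ψ (u x) with hp
  set q := deriv (deriv ψ) (u x) with hq
  have hgf : grad (fun y => ψ (u y)) x = p • n := grad_comp hψ1 hu1
  have hdf : ∀ v, diff (fun y => ψ (u y)) x v = p * diff u x v := fun v => by
    rw [diff_comp hψ1 hu1]; rfl
  have hnorm : φ x ^ 2 * ‖grad (fun y => ψ (u y)) x‖ ^ 2 = (φ x * p) ^ 2 := by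
    rw [hgf, norm_smul, hnn, mul_one, Real.norm_eq_abs, sq_abs]; ring
  have htensor : ∀ v w, jangTensor φ k (fun y => ψ (u y)) x v w =
      (φ x * (q * diff u x v * diff u x w + p * hessian u x v w)
        + diff φ x v * (p * diff u x w) + diff φ x w * (p * diff u x v))
        / √(1 + (φ x * p) ^ 2) - k x v w := fun v w => by
    rw [jangTensor, hnorm, hessian_comp hu hψ, hdf, hdf]
  have hun : diff u x n = 1 := by
    rw [diff_eq_inner_grad, ← hn, real_inner_self_eq_norm_sq, hnn, one_pow]
  have hTnn : jangTensor φ k (fun y => ψ (u y)) x n n =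
      (φ x * q + 2 * diff φ x n * p) / √(1 + (φ x * p) ^ 2) - k x n n := by
    rw [htensor, hun, hessian_grad_grad_eq_zero hx hu h1]
    ring
  have htr : trace (jangTensor φ k (fun y => ψ (u y)) x) =
      trace (V := levelTangent u x) (fun v w => jangTensor φ k (fun y => ψ (u y)) x v w)
        + jangTensor φ k (fun y => ψ (u y)) x n n :=
    trace_eq_trace_add_apply (jangTensorₗ φ k hf) hnn (levelTangent u x) fun v => by
      rw [levelTangent, LinearMap.mem_ker, hn, ← diff_eq_inner_grad]
      rfl
  have htr2 : trace (V := levelTangent u x) (fun v w => jangTensor φ k (fun y => ψ (u y)) x v w) =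
      φ x * p / √(1 + (φ x * p) ^ 2) * levelMeanCurvature u x
      - trace (V := levelTangent u x) (fun v w => k x v w) := by
    rw [levelMeanCurvature, trace, trace, trace, Finset.mul_sum, ← Finset.sum_sub_distrib]
    refine Finset.sum_congr rfl fun i _ => ?_
    have h0 : ∀ v : levelTangent u x, diff u x v = 0 := fun v => v.2
    rw [htensor, h0, ← hn, hnn]
    ring
  have hTff : jangTensor φ k (fun y => ψ (u y)) x (p • n) (p • n) =
      p ^ 2 * jangTensor φ k (fun y => ψ (u y)) x n n := by
    have e1 := (jangTensorₗ φ k hf).map_smul₂ p n (p • n)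
    have e2 := (jangTensorₗ φ k hf n).map_smul p n
    simp only [jangTensorₗ, LinearMap.mk₂_apply, smul_eq_mul] at e1 e2
    rw [e1, e2]; ring
  -- The normal entry of the tensor occurs once in the trace and once in the contraction with `∇f`;
  -- its total weight is `1 - v²/(1+v²) = (1+v²)⁻¹`, with `v = φ x * p`.
  rw [jangOperator, hnorm, hgf, hTff, htr, htr2, hTnn]
  have hpos : 1 + (φ x * p) ^ 2 ≠ 0 := by positivity
  field_simp
  ring
end Operator

/-! ### Eikonal equation and uniform bounds in the boundary collar. -/

section Collar
variable {M : Type*} [MetricSpace M] [ChartedSpace (EuclideanHalfSpace 3) M]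

theorem continuous_bdryDist : Continuous (bdryDist M) := Metric.continuous_infDist_pt _

theorem isOpen_collar (τ₀ : ℝ) : IsOpen {x | bdryDist M x < τ₀} :=
  isOpen_lt continuous_bdryDist continuous_const

theorem boundary_nonempty_of_bdryDist_pos {x : M} (hx : 0 < bdryDist M x) :
    (ModelWithCorners.boundary (I := 𝕀) M).Nonempty := by
  rw [nonempty_iff_ne_empty]
  intro h
  rw [bdryDist, h, Metric.infDist_empty] at hx
  exact lt_irrefl _ hx

theorem isInteriorPoint_of_bdryDist_pos {x : M} (hx : 0 < bdryDist M x) :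
    ModelWithCorners.IsInteriorPoint 𝕀 x := by
  rw [ModelWithCorners.isInteriorPoint_iff_not_isBoundaryPoint]
  intro h
  exact hx.ne' (Metric.infDist_zero_of_mem h)

variable [IsManifold 𝕀 ∞ M] [RiemannianBundle (fun x : M => 𝕋 x)]
  [IsContMDiffRiemannianBundle 𝕀 ∞ (EuclideanSpace ℝ (Fin 3)) (fun x : M => 𝕋 x)]

/-- In the collar, the distance to the boundary solves the eikonal equation. -/
theorem norm_grad_bdryDist [IsRiemannianManifold 𝕀 M] {τ₀ : ℝ}
    (hcollar : ContMDiffOn 𝕀 𝓘(ℝ, ℝ) ∞ (bdryDist M) {x | bdryDist M x < τ₀}) {x : M}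
    (hx : 0 < bdryDist M x) (hx' : bdryDist M x < τ₀) : ‖grad (bdryDist M) x‖ = 1 := by
  have : IsContinuousRiemannianBundle (EuclideanSpace ℝ (Fin 3)) (fun x : M => 𝕋 x) :=
    isContinuousRiemannianBundle_of_contMDiff 𝕀 ∞ _ _
  have hev : ∀ᶠ y in 𝓝 x, ContMDiffAt 𝕀 𝓘(ℝ, ℝ) 1 (bdryDist M) y := by
    filter_upwards [(isOpen_collar τ₀).mem_nhds hx'] with y hy
    exact (hcollar.contMDiffAt ((isOpen_collar τ₀).mem_nhds hy)).of_le (by simp)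
  rw [norm_grad]
  refine le_antisymm ?_ ?_
  · refine ContinuousLinearMap.opNorm_le_bound _ zero_le_one fun v => ?_
    have hLip : ∀ x y : M, bdryDist M y - bdryDist M x ≤ dist x y := fun x y => by
      have := Metric.infDist_le_infDist_add_dist (s := ModelWithCorners.boundary (I := 𝕀) M)
        (x := y) (y := x)
      rw [dist_comm, bdryDist, bdryDist]; linarith
    have key := mvfderiv_apply_le_norm hLip (isInteriorPoint_of_bdryDist_pos hx)
      (hev.self_of_nhds.mdifferentiableAt one_ne_zero)
    rw [one_mul, Real.norm_eq_abs, abs_le']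
    refine ⟨key v, ?_⟩
    rw [← map_neg, ← norm_neg v]
    exact key (-v)
  · exact norm_le_mvfderiv_of_infDist (boundary_nonempty_of_bdryDist_pos hx) hx hev

/-- Smooth data are bounded near each boundary point; compactness gives one constant on a
neighbourhood of the boundary, and that neighbourhood contains a metric collar, again by
compactness. A single `C ≥ 1` serves all four bounds because they weaken as `C` grows. -/
theorem exists_collar_bounds (hM : IsCompact (ModelWithCorners.boundary (I := 𝕀) M))
    {k : ∀ x : M, 𝕋 x →L[ℝ] 𝕋 x →L[ℝ] ℝ}
    (hk : Continuous (fun x => TotalSpace.mk'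
        (EuclideanSpace ℝ (Fin 3) →L[ℝ] EuclideanSpace ℝ (Fin 3) →L[ℝ] ℝ)
        (E := fun x : M => 𝕋 x →L[ℝ] 𝕋 x →L[ℝ] ℝ) x (k x)))
    {τ₀ : ℝ} (hτ₀ : 0 < τ₀) {g : M → ℝ}
    (hg : ContMDiffOn 𝕀 𝓘(ℝ, ℝ) ∞ g {x | bdryDist M x < τ₀})
    (hgpos : ∀ x, bdryDist M x < τ₀ → 0 < g x) :
    ∃ C, 1 ≤ C ∧ ∃ δ > 0, δ ≤ τ₀ ∧ ∀ x, 0 < bdryDist M x → bdryDist M x < δ →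
      (∀ v w : 𝕋 x, |k x v w| ≤ C * ‖v‖ * ‖w‖) ∧ ‖diff g x‖ ≤ C ∧ C⁻¹ ≤ g x ∧ g x ≤ C := by
  have : IsContinuousRiemannianBundle (EuclideanSpace ℝ (Fin 3)) (fun x : M => 𝕋 x) :=
    isContinuousRiemannianBundle_of_contMDiff 𝕀 ∞ _ _
  set P : ℝ → M → Prop := fun C x =>
    (∀ v w : 𝕋 x, |k x v w| ≤ C * ‖v‖ * ‖w‖) ∧ ‖diff g x‖ ≤ C ∧ C⁻¹ ≤ g x ∧ g x ≤ C with hP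
  have hmono : ∀ C C' x, 1 ≤ C → C ≤ C' → P C x → P C' x := by
    rintro C C' x h1 h ⟨h2, h3, h4, h5⟩
    refine ⟨fun v w => (h2 v w).trans (by gcongr), h3.trans h, le_trans ?_ h4, h5.trans h⟩
    gcongr
  have hloc : ∀ x ∈ ModelWithCorners.boundary (I := 𝕀) M, ∃ C, 1 ≤ C ∧ ∀ᶠ y in 𝓝 x, P C y := by
    intro x hx
    have hx0 : bdryDist M x < τ₀ := by
      rw [bdryDist, Metric.infDist_zero_of_mem hx]; exact hτ₀
    have hgx : ContMDiffAt 𝕀 𝓘(ℝ, ℝ) 1 g x :=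
      (hg.contMDiffAt ((isOpen_collar τ₀).mem_nhds hx0)).of_le (by simp)
    obtain ⟨C₁, hC₁⟩ := exists_eventually_abs_apply_le hk x
    have h2 := eventually_norm_mvfderiv_lt hgx (lt_add_one _)
    have hpos := hgpos x hx0
    have h3 := hgx.continuousAt.eventually (lt_mem_nhds (half_lt_self hpos))
    have h4 := hgx.continuousAt.eventually (gt_mem_nhds (lt_add_one (g x)))
    refine ⟨max 1 (max C₁ (max (‖diff g x‖ + 1) (max (g x / 2)⁻¹ (g x + 1)))), le_max_left _ _, ?_⟩
    filter_upwards [hC₁, h2, h3, h4] with y k1 k2 k3 k4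
    set C := max 1 (max C₁ (max (‖diff g x‖ + 1) (max (g x / 2)⁻¹ (g x + 1))))
    have i1 : C₁ ≤ C := by simp [C]
    have i2 : ‖diff g x‖ + 1 ≤ C := by simp [C]
    have i3 : (g x / 2)⁻¹ ≤ C := by simp [C]
    have i4 : g x + 1 ≤ C := by simp [C]
    refine ⟨fun v w => (k1 v w).trans (by gcongr), k2.le.trans i2, ?_, k4.le.trans i4⟩
    exact (inv_le_of_inv_le₀ (by positivity) i3).trans k3.le
  obtain ⟨C, hC1, hC⟩ : ∃ C, 1 ≤ C ∧
      ∀ᶠ y in 𝓝ˢ (ModelWithCorners.boundary (I := 𝕀) M), P C y := by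
    refine hM.induction_on (p := fun S => ∃ C, 1 ≤ C ∧ ∀ᶠ y in 𝓝ˢ S, P C y)
      ⟨1, le_rfl, by simp⟩ ?_ ?_ ?_
    · rintro S T hST ⟨C, h1, h2⟩
      exact ⟨C, h1, h2.filter_mono (nhdsSet_mono hST)⟩
    · rintro S T ⟨C, h1, h2⟩ ⟨C', h1', h2'⟩
      refine ⟨max C C', h1.trans (le_max_left _ _), ?_⟩
      rw [nhdsSet_union, eventually_sup]
      exact ⟨h2.mono fun x => hmono _ _ x h1 (le_max_left _ _),
        h2'.mono fun x => hmono _ _ x h1' (le_max_right _ _)⟩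
    · intro x hx
      obtain ⟨C, h1, h2⟩ := hloc x hx
      obtain ⟨U, hU, hUo, hxU⟩ := eventually_nhds_iff.1 h2
      exact ⟨U, mem_nhdsWithin_of_mem_nhds (hUo.mem_nhds hxU), C, h1,
        (hUo.mem_nhdsSet.2 Subset.rfl : U ∈ 𝓝ˢ U) |> fun h => mem_of_superset h hU⟩
  obtain ⟨U, hUo, hSU, hU⟩ := mem_nhdsSet_iff_exists.1 hC
  obtain ⟨δ, hδ, hthick⟩ := hM.exists_thickening_subset_open hUo hSU
  refine ⟨C, hC1, min δ τ₀, lt_min hδ hτ₀, min_le_right _ _, fun x hx hxδ => ?_⟩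
  refine hU (hthick ?_)
  rw [Metric.mem_thickening_iff_infDist_lt (boundary_nonempty_of_bdryDist_pos hx)]
  exact hxδ.trans_le (min_le_left _ _)
end Collar

/-! ### The scalar expansion of the radial Jang operator. -/

section Scalar

/-- Here `T = t^b`, `Q = t^{-q}`, `S = t^s`, `u = 1 + σ t^s`, `Φ` and `D` are the value and normal
derivative of `φtilde`, and `κ = k(n,n)`. Treating the powers as independent positive numbers turns
the expansion into algebra in `v` and `W = √(1+v²)`, with common factor `(v² t)⁻¹`. -/
theorem radial_expansion {T Q S t u Φ A D b q s σ H K κ : ℝ} (hT : 0 < T) (hQ : 0 < Q) (ht : 0 < t)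
    (hu : 0 < u) (hΦ : 0 < Φ) (hA : 0 < A) (hv : 2 ≤ T * Φ * (A * Q * u)) :
    ∃ ρ e : ℝ, 1 / 2 ≤ ρ ∧ ρ ≤ 1 ∧ |e| ≤ |H| + |κ| ∧
      (T * Φ * -(A * Q * u) / √(1 + (T * Φ * -(A * Q * u)) ^ 2) * H - K
        + (1 + (T * Φ * -(A * Q * u)) ^ 2)⁻¹ *
          ((T * Φ * (A * q * Q * u / t - A * σ * s * S * Q / t)
            + 2 * (b * T * Φ / t + T * D) * -(A * Q * u))
            / √(1 + (T * Φ * -(A * Q * u)) ^ 2) - κ)) + (H + K) =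
      (A ^ 2 * Φ ^ 2 * u ^ 2)⁻¹ * (T ^ 2 * Q ^ 2 * t)⁻¹ *
        (ρ * (q - 2 * b - σ * s * S / u - 2 * t * D / Φ) + t * e) := by
  set v := T * Φ * (A * Q * u) with hvdef
  have hv0 : 0 < v := by linarith
  have e1 : T * Φ * -(A * Q * u) = -v := by rw [hvdef]; ring
  rw [e1, neg_sq]
  set W := √(1 + v ^ 2) with hW
  have hW2 : W ^ 2 = 1 + v ^ 2 := Real.sq_sqrt (by positivity)
  have hWpos : 0 < W := Real.sqrt_pos.2 (by positivity)
  have hvW : v < W := by nlinarith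
  set r := v / W with hr
  have hr1 : r < 1 := (div_lt_one hWpos).2 hvW
  have hr0 : 0 < r := by positivity
  have hrsq : r ^ 2 = 1 - (W ^ 2)⁻¹ := by
    rw [hr, div_pow, hW2]; field_simp; ring
  have hr2 : 4 / 5 ≤ r ^ 2 := by
    rw [hr, div_pow, hW2, div_le_div_iff₀ (by norm_num) (by positivity)]; nlinarith
  -- With `r = v/W`, the second-order term carries `v/W³ = r³/v²`, and `v ≥ 2` gives `r² ≥ 4/5`,
  -- hence `r³ ≥ 1/2`. The remainder stays bounded after multiplication by `v²` because `1 - r ≤ 1 -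
  -- r² = W⁻²`.
  refine ⟨r ^ 3, v ^ 2 * ((1 - r) * H - (W ^ 2)⁻¹ * κ), by nlinarith, by nlinarith, ?_, ?_⟩
  · have h1 : 0 ≤ v ^ 2 * (1 - r) := by
      have := sub_pos.2 hr1
      positivity
    have h3 : v ^ 2 * (W ^ 2)⁻¹ = r ^ 2 := by rw [hr]; field_simp
    have h2 : v ^ 2 * (1 - r) ≤ 1 := by
      have h4 : 1 - r ≤ (W ^ 2)⁻¹ := by nlinarith
      calc v ^ 2 * (1 - r) ≤ v ^ 2 * (W ^ 2)⁻¹ := by gcongr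
        _ ≤ 1 := by rw [h3]; nlinarith
    have h5 : v ^ 2 * ((1 - r) * H - (W ^ 2)⁻¹ * κ) = v ^ 2 * (1 - r) * H - r ^ 2 * κ := by
      rw [← h3]; ring
    rw [h5]
    calc _ ≤ |v ^ 2 * (1 - r) * H| + |r ^ 2 * κ| := abs_sub _ _
      _ = v ^ 2 * (1 - r) * |H| + r ^ 2 * |κ| := by
        rw [abs_mul _ H, abs_mul _ κ, abs_of_nonneg h1, abs_of_nonneg (sq_nonneg r)]
      _ ≤ 1 * |H| + 1 * |κ| := by
        have : r ^ 2 ≤ 1 := by nlinarith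
        gcongr
      _ = _ := by ring
  · rw [← hW2]
    have hid : (A ^ 2 * Φ ^ 2 * u ^ 2)⁻¹ * (T ^ 2 * Q ^ 2 * t)⁻¹ = (v ^ 2 * t)⁻¹ := by
      rw [← mul_inv, hvdef]; congr 1; ring
    have hE : T * Φ * (A * q * Q * u / t - A * σ * s * S * Q / t)
            + 2 * (b * T * Φ / t + T * D) * -(A * Q * u) =
        v / t * (q - 2 * b - σ * s * S / u - 2 * t * D / Φ) := by
      rw [hvdef]; field_simp; ring
    rw [hid, hE, hr]
    field_simp
    ring

end Scalar

/-! ### The radial ansatz and its comparison with the model profile. -/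

section Profile

/-- A primitive of `t ↦ t ^ r` on `(0, ∞)`. -/
def rpowPrimitive (r t : ℝ) : ℝ := if r = -1 then Real.log t else t ^ (r + 1) / (r + 1)

theorem hasDerivAt_rpowPrimitive (r : ℝ) {t : ℝ} (ht : 0 < t) :
    HasDerivAt (rpowPrimitive r) (t ^ r) t := by
  unfold rpowPrimitive
  split_ifs with h
  · rw [h, Real.rpow_neg_one]
    exact Real.hasDerivAt_log ht.ne'
  · have h1 : r + 1 ≠ 0 := fun h' => h (by linarith)
    refine ((Real.hasDerivAt_rpow_const (p := r + 1) (Or.inl ht.ne')).div_const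
      (r + 1)).congr_deriv ?_
    rw [add_sub_cancel_right]
    field_simp

theorem contDiffOn_rpowPrimitive (r : ℝ) : ContDiffOn ℝ ∞ (rpowPrimitive r) (Ioi 0) := by
  unfold rpowPrimitive
  split_ifs with h
  · exact Real.contDiffOn_log.mono fun t ht => (mem_Ioi.1 ht).ne'
  · exact (contDiffOn_id.rpow_const_of_ne fun t ht => (mem_Ioi.1 ht).ne').div_const _

/-- The radial function with derivative `-A t^{-q} (1 + σ t^s)`. -/
def radialFun (A q σ s c t : ℝ) : ℝ :=
  c - A * (rpowPrimitive (-q) t + σ * rpowPrimitive (-q + s) t)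

variable {A q σ s c : ℝ}

theorem hasDerivAt_radialFun {t : ℝ} (ht : 0 < t) :
    HasDerivAt (radialFun A q σ s c) (-(A * t ^ (-q) * (1 + σ * t ^ s))) t := by
  refine ((((hasDerivAt_rpowPrimitive (-q) ht).add
    ((hasDerivAt_rpowPrimitive (-q + s) ht).const_mul σ)).const_mul A).const_sub c).congr_deriv ?_
  rw [Real.rpow_add ht]; ring

theorem contDiffOn_radialFun : ContDiffOn ℝ ∞ (radialFun A q σ s c) (Ioi 0) :=
  contDiffOn_const.sub (contDiffOn_const.mul ((contDiffOn_rpowPrimitive _).add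
    (contDiffOn_const.mul (contDiffOn_rpowPrimitive _))))

theorem deriv_radialFun {t : ℝ} (ht : 0 < t) :
    deriv (radialFun A q σ s c) t = -(A * t ^ (-q) * (1 + σ * t ^ s)) :=
  (hasDerivAt_radialFun ht).deriv

theorem deriv_deriv_radialFun {t : ℝ} (ht : 0 < t) :
    deriv (deriv (radialFun A q σ s c)) t =
      A * q * t ^ (-q) * (1 + σ * t ^ s) / t - A * σ * s * t ^ s * t ^ (-q) / t := by
  have hev : deriv (radialFun A q σ s c) =ᶠ[𝓝 t] fun t => -(A * t ^ (-q) * (1 + σ * t ^ s)) := by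
    filter_upwards [lt_mem_nhds ht] with y hy using deriv_radialFun hy
  rw [hev.deriv_eq]
  have h1 := Real.hasDerivAt_rpow_const (x := t) (p := -q) (Or.inl ht.ne')
  have h2 := Real.hasDerivAt_rpow_const (x := t) (p := s) (Or.inl ht.ne')
  have h3 : HasDerivAt (fun t => -(A * t ^ (-q) * (1 + σ * t ^ s))) _ t :=
    ((h1.const_mul A).mul ((h2.const_mul σ).const_add 1)).neg
  rw [h3.deriv, Real.rpow_sub_one ht.ne', Real.rpow_sub_one ht.ne']
  ring

/-- The constant `m > 0` with `(profile p)' = -m t^{-p-1}`. -/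
def profileSlope (p : ℝ) : ℝ := if p = 0 then 1 else p

theorem profileSlope_pos {p : ℝ} (hp : 0 ≤ p) : 0 < profileSlope p := by
  unfold profileSlope
  split_ifs with h
  · exact one_pos
  · exact lt_of_le_of_ne hp (Ne.symm h)

theorem hasDerivAt_profile (p : ℝ) {t : ℝ} (ht : 0 < t) :
    HasDerivAt (profile p) (-(profileSlope p * t ^ (-(p + 1)))) t := by
  unfold profile profileSlope
  split_ifs with h
  · rw [h, zero_add, Real.rpow_neg_one, one_mul]
    exact (Real.hasDerivAt_log ht.ne').neg
  · convert Real.hasDerivAt_rpow_const (p := -p) (Or.inl ht.ne') using 1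
    rw [neg_add']; ring

theorem profile_nonneg (p : ℝ) {t : ℝ} (ht : 0 < t) (ht1 : t ≤ 1) : 0 ≤ profile p t := by
  unfold profile
  split_ifs
  · exact neg_nonneg.2 (Real.log_nonpos ht.le ht1)
  · positivity

theorem half_le_one_add_mul_rpow {τ t : ℝ} (hs : 0 ≤ s) (hτ : |σ| * τ ^ s ≤ 1 / 2) (ht : 0 < t)
    (htτ : t ≤ τ) : 1 / 2 ≤ 1 + σ * t ^ s ∧ 1 + σ * t ^ s ≤ 3 / 2 := by
  have h : |σ * t ^ s| ≤ 1 / 2 := by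
    rw [abs_mul, abs_of_nonneg (Real.rpow_nonneg ht.le s)]
    refine le_trans ?_ hτ
    gcongr
  have := abs_le.1 h
  constructor <;> linarith

/-- Only derivatives are compared: the slope of the ansatz lies between `A/2` and `3A/2` times
`-t^{-(p+1)}`, and the profile has slope `-m t^{-(p+1)}`. This treats the logarithmic cases
uniformly. The bounds hold for all larger `α` and `β`, so that two functions can share them. -/
theorem exists_radialFun_bounds {p τ : ℝ} (hp : 0 ≤ p) (hA : 0 < A) (hs : 0 ≤ s) (hτ : 0 < τ)
    (hτ1 : τ ≤ 1) (hτσ : |σ| * τ ^ s ≤ 1 / 2) :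
    ∃ c a : ℝ, 1 ≤ a ∧ ∀ α ≥ a, ∀ β ≥ a, ∀ t ∈ Ioo 0 τ,
      α⁻¹ * profile p t + β⁻¹ ≤ radialFun A (p + 1) σ s c t ∧
        radialFun A (p + 1) σ s c t ≤ α * profile p t + β := by
  have hm := profileSlope_pos hp
  set m := profileSlope p
  have hsub : ∀ c t, radialFun A (p + 1) σ s c t = c + radialFun A (p + 1) σ s 0 t := fun c t => by
    unfold radialFun; ring
  set ψ := radialFun A (p + 1) σ s 0
  have hd : ∀ r t, 0 < t → HasDerivAt (fun t => ψ t - r / m * profile p t)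
      (t ^ (-(p + 1)) * (r - A * (1 + σ * t ^ s))) t := fun r t ht => by
    refine ((hasDerivAt_radialFun ht).sub
      ((hasDerivAt_profile p ht).const_mul (r / m))).congr_deriv ?_
    change _ - r / m * -(m * _) = _
    field_simp
    ring
  have hcont : ∀ r, ContinuousOn (fun t => ψ t - r / m * profile p t) (Ioc 0 τ) := fun r t ht =>
    (hd r t ht.1).continuousAt.continuousWithinAt
  have hdiff : ∀ r, DifferentiableOn ℝ (fun t => ψ t - r / m * profile p t)
      (interior (Ioc 0 τ)) := fun r t ht =>
    (hd r t (interior_subset ht).1).differentiableAt.differentiableWithinAt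
  have anti : AntitoneOn (fun t => ψ t - (A / 2) / m * profile p t) (Ioc 0 τ) := by
    refine antitoneOn_of_deriv_nonpos (convex_Ioc _ _) (hcont _) (hdiff _) fun t ht => ?_
    have ht := interior_subset ht
    rw [(hd _ t ht.1).deriv]
    refine mul_nonpos_of_nonneg_of_nonpos (Real.rpow_nonneg ht.1.le _) ?_
    nlinarith [(half_le_one_add_mul_rpow hs hτσ ht.1 ht.2).1]
  have mono : MonotoneOn (fun t => ψ t - (3 * A / 2) / m * profile p t) (Ioc 0 τ) := by
    refine monotoneOn_of_deriv_nonneg (convex_Ioc _ _) (hcont _) (hdiff _) fun t ht => ?_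
    have ht := interior_subset ht
    rw [(hd _ t ht.1).deriv]
    refine mul_nonneg (Real.rpow_nonneg ht.1.le _) ?_
    nlinarith [(half_le_one_add_mul_rpow hs hτσ ht.1 ht.2).2]
  -- The additive constant makes `ψ - (A/2)/m * profile` equal to 1 at `τ`, hence at least 1 on the
  -- interval, which leaves room for `β⁻¹ ≤ 1`.
  set c := 1 - (ψ τ - (A / 2) / m * profile p τ) with hc
  set B := c + (ψ τ - (3 * A / 2) / m * profile p τ) with hB
  refine ⟨c, max 1 (max ((A / 2) / m)⁻¹ (max ((3 * A / 2) / m) B)), le_max_left _ _,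
    fun α hα β hβ t ht => ?_⟩
  simp only [ge_iff_le, max_le_iff] at hα hβ
  have hP := profile_nonneg p ht.1 (ht.2.le.trans hτ1)
  have ht' : t ∈ Ioc 0 τ := ⟨ht.1, ht.2.le⟩
  have hτ' : τ ∈ Ioc 0 τ := ⟨hτ, le_rfl⟩
  have h1 := anti ht' hτ' ht.2.le
  have h2 := mono ht' hτ' ht.2.le
  simp only at h1 h2
  rw [hsub]
  constructor
  · have h3 : α⁻¹ ≤ (A / 2) / m := inv_le_of_inv_le₀ (by positivity) hα.2.1
    have h4 : β⁻¹ ≤ 1 := inv_le_one_of_one_le₀ hβ.1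
    have h5 := mul_le_mul_of_nonneg_right h3 hP
    linarith
  · have h5 := mul_le_mul_of_nonneg_right hα.2.2.1 hP
    linarith [hβ.2.2.2]

end Profile

section RadialProfile
variable {M : Type*} [MetricSpace M] [ChartedSpace (EuclideanHalfSpace 3) M]

/-- The blow-up comes from `φ |ψ'| ≥ (C A / 2) t^{b-(p+1)}`, whose exponent is negative. -/
theorem isRadialProfile_radialFun {φ : M → ℝ} {b C p τ₁ A σ s c α β : ℝ} (hbp : b < p + 1)
    (hA : 0 < A) (hC : 0 < C) (hs : 0 ≤ s) (hτ₁ : 0 < τ₁) (hτσ : |σ| * τ₁ ^ s ≤ 1 / 2)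
    (hφ : ∀ x, 0 < bdryDist M x → bdryDist M x < τ₁ → C * bdryDist M x ^ b ≤ φ x)
    (hbd : ∀ t ∈ Ioo 0 τ₁,
      α⁻¹ * profile p t + β⁻¹ ≤ radialFun A (p + 1) σ s c t ∧
        radialFun A (p + 1) σ s c t ≤ α * profile p t + β) :
    IsRadialProfile φ τ₁ p α β (radialFun A (p + 1) σ s c) where
  smooth := contDiffOn_radialFun.mono fun t ht => ht.1
  deriv_neg t ht := by
    rw [deriv_radialFun ht.1]
    have h1 := (half_le_one_add_mul_rpow hs hτσ ht.1 ht.2.le).1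
    have h2 := Real.rpow_pos_of_pos ht.1 (-(p + 1))
    have : 0 < 1 + σ * t ^ s := by linarith
    exact neg_neg_of_pos (by positivity)
  blowup := by
    have h0 : Tendsto (fun t : ℝ => C * A / 2 * t ^ (b - (p + 1))) (𝓝[>] 0) atTop :=
      (tendsto_rpow_neg_nhdsGT_zero (by linarith)).const_mul_atTop (by positivity)
    refine tendsto_atTop_mono' _ ?_ (h0.comp tendsto_comap)
    have : ∀ᶠ t in 𝓝[>] (0 : ℝ), t ∈ Ioo 0 τ₁ := Ioo_mem_nhdsGT hτ₁
    filter_upwards [tendsto_comap.eventually this] with x hx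
    set t := bdryDist M x
    rw [Function.comp_apply, deriv_radialFun hx.1, mul_neg, abs_neg]
    refine le_trans ?_ (le_abs_self _)
    have h1 := (half_le_one_add_mul_rpow hs hτσ hx.1 hx.2.le).1
    have h2 := hφ x hx.1 hx.2
    have h3 := Real.rpow_pos_of_pos hx.1 b
    rw [sub_eq_add_neg, Real.rpow_add hx.1]
    calc _ = (C * t ^ b) * (A * t ^ (-(p + 1)) * (1 / 2)) := by ring
      _ ≤ φ x * (A * t ^ (-(p + 1)) * (1 + σ * t ^ s)) := by
        have := Real.rpow_pos_of_pos hx.1 (-(p + 1))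
        gcongr
        exact (mul_pos hC h3).le.trans h2
  lower t ht := (hbd t ht).1
  upper t ht := (hbd t ht).2

end RadialProfile

/-! ### The expansion of the Jang operator on the ansatz, with geometric error bounds. -/

section Expansion
variable {M : Type*} [MetricSpace M] [ChartedSpace (EuclideanHalfSpace 3) M]
  [IsManifold 𝕀 ∞ M] [RiemannianBundle (fun x : M => 𝕋 x)]

theorem abs_trace_le {V : Type*} [NormedAddCommGroup V] [InnerProductSpace ℝ V]
    [FiniteDimensional ℝ V] {B : V → V → ℝ} {C : ℝ} (hB : ∀ v, ‖v‖ = 1 → |B v v| ≤ C) :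
    |trace B| ≤ Module.finrank ℝ V * C := by
  unfold trace
  refine (Finset.abs_sum_le_sum_abs _ _).trans ?_
  refine (Finset.sum_le_sum fun i _ => hB _ ((stdOrthonormalBasis ℝ V).norm_eq_one i)).trans ?_
  simp

omit [IsManifold 𝕀 ∞ M] in
theorem abs_trace_levelTangent_le {k : ∀ x : M, 𝕋 x →L[ℝ] 𝕋 x →L[ℝ] ℝ} {u : M → ℝ} {x : M} {C : ℝ}
    (hC : 0 ≤ C) (hk : ∀ v w : 𝕋 x, |k x v w| ≤ C * ‖v‖ * ‖w‖) :
    |trace (V := levelTangent u x) (fun v w => k x v w)| ≤ 3 * C := by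
  refine (abs_trace_le (C := C) fun v hv => ?_).trans ?_
  · have hv' : ‖(v : 𝕋 x)‖ = 1 := hv
    simpa [hv'] using hk v v
  · have h1 : Module.finrank ℝ (levelTangent u x) ≤ 3 := by
      refine (Submodule.finrank_le _).trans (le_of_eq ?_)
      exact finrank_euclideanSpace_fin (𝕜 := ℝ) (n := 3)
    have : (Module.finrank ℝ (levelTangent u x) : ℝ) ≤ 3 := by exact_mod_cast h1
    gcongr

omit [IsManifold 𝕀 ∞ M] in
theorem diff_rpow_mul_apply_grad {φ g u : M → ℝ} {b : ℝ} {x : M}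
    (hφ : φ =ᶠ[𝓝 x] fun y => u y ^ b * g y) (hu : MDifferentiableAt 𝕀 𝓘(ℝ, ℝ) u x)
    (hg : MDifferentiableAt 𝕀 𝓘(ℝ, ℝ) g x) (hx : 0 < u x) (hn : ‖grad u x‖ = 1) :
    diff φ x (grad u x) =
      b * u x ^ b * g x / u x + u x ^ b * diff g x (grad u x) := by
  have h1 : HasDerivAt (fun t : ℝ => t ^ b) (b * u x ^ (b - 1)) (u x) :=
    Real.hasDerivAt_rpow_const (Or.inl hx.ne')
  have h2 := diff_comp (u := u) (x := x) (ψ := fun t : ℝ => t ^ b) h1.differentiableAt hu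
  have h3 : diff u x (grad u x) = 1 := by
    rw [diff_eq_inner_grad, real_inner_self_eq_norm_sq, hn, one_pow]
  have h4 : MDifferentiableAt 𝕀 𝓘(ℝ, ℝ) (fun y => u y ^ b) x :=
    h1.differentiableAt.mdifferentiableAt.comp x hu
  rw [diff_congr hφ, diff, mvfderiv_fun_mul h4 hg]
  change u x ^ b * diff g x (grad u x) + g x * diff (fun y => u y ^ b) x (grad u x) = _
  rw [h2, h1.deriv, _root_.smul_apply, h3, Real.rpow_sub_one hx.ne', smul_eq_mul]
  ring

variable [IsContMDiffRiemannianBundle 𝕀 ∞ (EuclideanSpace ℝ (Fin 3)) (fun x : M => 𝕋 x)]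

/-- In the bound for `e`, the mean curvature is `θ₊ - Tr_S k`, and the trace costs at most `3C`; the
remaining `C` comes from `k(∇τ, ∇τ)`. -/
theorem jangOperator_radialFun [IsRiemannianManifold 𝕀 M] {τ₀ : ℝ}
    (hcollar : ContMDiffOn 𝕀 𝓘(ℝ, ℝ) ∞ (bdryDist M) {x | bdryDist M x < τ₀})
    {k : ∀ x : M, 𝕋 x →L[ℝ] 𝕋 x →L[ℝ] ℝ} {φ φtilde : M → ℝ} {b C : ℝ}
    (hφtilde : ContMDiffOn 𝕀 𝓘(ℝ, ℝ) ∞ φtilde {x | bdryDist M x < τ₀})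
    (hφ : ∀ x, bdryDist M x < τ₀ → φ x = bdryDist M x ^ b * φtilde x) {x : M}
    (hx : 0 < bdryDist M x) (hx' : bdryDist M x < τ₀) (hC : 0 ≤ C)
    (hk : ∀ v w : 𝕋 x, |k x v w| ≤ C * ‖v‖ * ‖w‖) (hd : ‖diff φtilde x‖ ≤ C)
    (hpos : 0 < φtilde x) {A q σ s c : ℝ} (hA : 0 < A) (hσ : 0 < 1 + σ * bdryDist M x ^ s)
    (hv : 2 ≤ bdryDist M x ^ b * φtilde x *
      (A * bdryDist M x ^ (-q) * (1 + σ * bdryDist M x ^ s))) :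
    ∃ ρ e D : ℝ, 1 / 2 ≤ ρ ∧ ρ ≤ 1 ∧ |e| ≤ |nullExpansion k (bdryDist M) x| + 4 * C ∧ |D| ≤ C ∧
      jangOperator φ k (fun y => radialFun A q σ s c (bdryDist M y)) x
        + nullExpansion k (bdryDist M) x =
      (A ^ 2 * φtilde x ^ 2 * (1 + σ * bdryDist M x ^ s) ^ 2)⁻¹ * bdryDist M x ^ (2 * q - 2 * b - 1)
        * (ρ * (q - 2 * b - σ * s * bdryDist M x ^ s / (1 + σ * bdryDist M x ^ s)
            - 2 * bdryDist M x * D / φtilde x) + bdryDist M x * e) := by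
  have hmem := (isOpen_collar τ₀).mem_nhds hx'
  have hgrad := norm_grad_bdryDist hcollar hx hx'
  have h1 : ∀ᶠ y in 𝓝 x, ‖grad (bdryDist M) y‖ = 1 := by
    filter_upwards [hmem, continuous_bdryDist.continuousAt.eventually (lt_mem_nhds hx)]
      with y hy hy' using norm_grad_bdryDist hcollar hy' hy
  have hu := hcollar.contMDiffAt hmem
  have hψ : ContDiffAt ℝ 2 (radialFun A q σ s c) (bdryDist M x) :=
    ((contDiffOn_radialFun (A := A) (q := q) (σ := σ) (s := s) (c := c)).contDiffAt
      (Ioi_mem_nhds hx)).of_le (by norm_cast)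
  have hJ := jangOperator_comp φ k (isInteriorPoint_of_bdryDist_pos hx)
    (hu.of_le (by norm_cast)) h1 hψ
  have hφev : φ =ᶠ[𝓝 x] fun y => bdryDist M y ^ b * φtilde y := by
    filter_upwards [hmem] with y hy using hφ y hy
  have hD := diff_rpow_mul_apply_grad hφev (hu.mdifferentiableAt (by simp))
    ((hφtilde.contMDiffAt hmem).mdifferentiableAt (by simp)) hx hgrad
  obtain ⟨ρ, e, hρ, hρ', he, heq⟩ := radial_expansion (S := bdryDist M x ^ s)
    (D := diff φtilde x (grad (bdryDist M) x)) (b := b) (q := q) (σ := σ) (s := s)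
    (H := levelMeanCurvature (bdryDist M) x)
    (K := trace (V := levelTangent (bdryDist M) x) (fun v w => k x v w))
    (κ := k x (grad (bdryDist M) x) (grad (bdryDist M) x))
    (Real.rpow_pos_of_pos hx b) (Real.rpow_pos_of_pos hx (-q)) hx hσ hpos hA hv
  refine ⟨ρ, e, diff φtilde x (grad (bdryDist M) x), hρ, hρ', ?_, ?_, ?_⟩
  · have h2 := abs_trace_levelTangent_le (u := bdryDist M) hC hk
    have h3 := hk (grad (bdryDist M) x) (grad (bdryDist M) x)
    rw [hgrad, mul_one, mul_one] at h3
    have h4 : levelMeanCurvature (bdryDist M) x = nullExpansion k (bdryDist M) x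
        - trace (V := levelTangent (bdryDist M) x) (fun v w => k x v w) := by
      rw [nullExpansion]; ring
    have h5 := abs_sub (nullExpansion k (bdryDist M) x)
      (trace (V := levelTangent (bdryDist M) x) (fun v w => k x v w))
    rw [← h4] at h5
    linarith
  · rw [← Real.norm_eq_abs]
    refine ((diff φtilde x).le_opNorm _).trans ?_
    rwa [hgrad, mul_one]
  · have hpow : (bdryDist M x) ^ (2 * q - 2 * b - 1) =
        ((bdryDist M x ^ b) ^ 2 * (bdryDist M x ^ (-q)) ^ 2 * bdryDist M x)⁻¹ := by
      rw [← Real.rpow_natCast, ← Real.rpow_natCast, ← Real.rpow_mul hx.le, ← Real.rpow_mul hx.le,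
        ← Real.rpow_add hx, ← Real.rpow_add_one hx.ne', ← Real.rpow_neg hx.le]
      congr 1
      push_cast
      ring
    rw [hpow, hJ, deriv_radialFun hx, deriv_deriv_radialFun hx, hD, hφ x hx', nullExpansion, ← heq]

end Expansion

/-! ### Two-sided control of the expansion in the two regimes. -/

section ScalarBounds

theorem abs_two_mul_div_le {C Φ D t : ℝ} (hC : 1 ≤ C) (hΦ : C⁻¹ ≤ Φ) (hD : |D| ≤ C) (ht : 0 < t) :
    |2 * t * D / Φ| ≤ t * (2 * C ^ 2) := by
  have hC0 : 0 < C := by linarith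
  have hΦ0 : 0 < Φ := lt_of_lt_of_le (by positivity) hΦ
  have h : Φ⁻¹ ≤ C := inv_le_of_inv_le₀ hC0 hΦ
  rw [div_eq_mul_inv, abs_mul, abs_mul, abs_of_pos (inv_pos.2 hΦ0), abs_of_pos (by positivity)]
  calc 2 * t * |D| * Φ⁻¹ ≤ 2 * t * C * C := by gcongr
    _ = _ := by ring

/-- Regime of part (1): the errors are small fractions of `d`, so the bracket lies in `[d/4, 2d]`.
Both resulting bounds scale like `A⁻²`, which is the free parameter. -/
theorem power_expansion_bounds {A C d t Φ D e E ρ R : ℝ} (hA : 0 < A) (hC : 1 ≤ C) (hd : 0 < d)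
    (ht : 0 < t) (hΦ : C⁻¹ ≤ Φ) (hΦ' : Φ ≤ C) (hD : |D| ≤ C) (he : |e| ≤ E) (hρ : 1 / 2 ≤ ρ)
    (hρ' : ρ ≤ 1) (hR : 0 ≤ R) (h1 : t * (2 * C ^ 2) ≤ d / 4) (h2 : t * E ≤ d / 8) :
    d / (4 * A ^ 2 * C ^ 2) * R ≤ (A ^ 2 * Φ ^ 2)⁻¹ * R * (ρ * (d - 2 * t * D / Φ) + t * e) ∧
      (A ^ 2 * Φ ^ 2)⁻¹ * R * (ρ * (d - 2 * t * D / Φ) + t * e) ≤ 2 * C ^ 2 * d / A ^ 2 * R := by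
  have hC0 : 0 < C := by linarith
  have hΦ0 : 0 < Φ := lt_of_lt_of_le (by positivity) hΦ
  have h3 := abs_le.1 ((abs_two_mul_div_le hC hΦ hD ht).trans h1)
  have h4 : |t * e| ≤ d / 8 := by
    rw [abs_mul, abs_of_pos ht]
    exact (by gcongr : t * |e| ≤ t * E).trans h2
  have h4 := abs_le.1 h4
  set δ := 2 * t * D / Φ
  have hX : d / 4 ≤ ρ * (d - δ) + t * e := by nlinarith [h3.2, h4.1]
  have hX' : ρ * (d - δ) + t * e ≤ 2 * d := by nlinarith [h3.1, h3.2, h4.2]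
  set X := ρ * (d - δ) + t * e
  have h5 : Φ⁻¹ ≤ C := inv_le_of_inv_le₀ hC0 hΦ
  constructor
  · calc d / (4 * A ^ 2 * C ^ 2) * R = (A ^ 2 * C ^ 2)⁻¹ * R * (d / 4) := by field_simp
      _ ≤ (A ^ 2 * Φ ^ 2)⁻¹ * R * X := by gcongr
  · calc (A ^ 2 * Φ ^ 2)⁻¹ * R * X ≤ (A ^ 2 * Φ ^ 2)⁻¹ * R * (2 * d) := by gcongr
      _ = (A ^ 2)⁻¹ * (Φ⁻¹) ^ 2 * R * (2 * d) := by rw [mul_inv, inv_pow Φ]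
      _ ≤ (A ^ 2)⁻¹ * C ^ 2 * R * (2 * d) := by gcongr
      _ = _ := by field_simp

/-- Regime of part (2): the leading coefficient is zero and `± m S / u` must beat errors of size `t
(2C² + E) ≤ S (2C² + E)`. The prefactor lies between `4/(9C²)` and `4C²`, and `ρ / u ≥ 1/3`; thus
the gain is at least `4/(27C²) m S`, which explains the constant `27/4` in `hN`. -/
theorem perturbed_expansion_bound {C N m t S u Φ D e E ρ R : ℝ} (hC : 1 ≤ C)
    (ht : 0 < t) (hS : t ≤ S) (hu : 1 / 2 ≤ u) (hu' : u ≤ 3 / 2) (hΦ : C⁻¹ ≤ Φ) (hΦ' : Φ ≤ C)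
    (hD : |D| ≤ C) (he : |e| ≤ E) (hρ : 1 / 2 ≤ ρ) (hρ' : ρ ≤ 1) (hR : 0 ≤ R) (hm : 0 ≤ m)
    (hN : 27 / 4 * C ^ 2 * (N + 4 * C ^ 2 * (2 * C ^ 2 + E)) ≤ m) :
    N * (R * S) ≤ (Φ ^ 2 * u ^ 2)⁻¹ * R * (ρ * (m * S / u - 2 * t * D / Φ) + t * e) ∧
      (Φ ^ 2 * u ^ 2)⁻¹ * R * (ρ * (-(m * S / u) - 2 * t * D / Φ) + t * e) ≤ -(N * (R * S)) := by
  have hC0 : 0 < C := by linarith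
  have hΦ0 : 0 < Φ := lt_of_lt_of_le (by positivity) hΦ
  have hS0 : 0 < S := ht.trans_le hS
  have hE : 0 ≤ E := (abs_nonneg e).trans he
  have h3 := abs_le.1 (abs_two_mul_div_le hC hΦ hD ht)
  have h4 : |t * e| ≤ t * E := by
    rw [abs_mul, abs_of_pos ht]
    gcongr
  have h4 := abs_le.1 h4
  set δ := 2 * t * D / Φ
  have h5 : Φ⁻¹ ≤ C := inv_le_of_inv_le₀ hC0 hΦ
  have hlow : 4 / 9 * (C ^ 2)⁻¹ ≤ (Φ ^ 2 * u ^ 2)⁻¹ := by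
    calc 4 / 9 * (C ^ 2)⁻¹ = (C ^ 2 * (3 / 2) ^ 2)⁻¹ := by field_simp; norm_num
      _ ≤ _ := by gcongr
  have hup : (Φ ^ 2 * u ^ 2)⁻¹ ≤ 4 * C ^ 2 := by
    calc (Φ ^ 2 * u ^ 2)⁻¹ = (Φ⁻¹) ^ 2 * (u ^ 2)⁻¹ := by rw [mul_inv, inv_pow Φ]
      _ ≤ C ^ 2 * ((1 / 2) ^ 2)⁻¹ := by gcongr
      _ = _ := by ring
  set F := (Φ ^ 2 * u ^ 2)⁻¹
  have hF : 0 ≤ F := by positivity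
  have hmain : m * S / 3 ≤ ρ * (m * S / u) := by
    have h6 : m * S * (2 / 3) ≤ m * S / u := by
      rw [le_div_iff₀ (by linarith)]
      nlinarith [mul_nonneg hm hS0.le]
    nlinarith [mul_nonneg hm hS0.le]
  have hc : N + 4 * C ^ 2 * (2 * C ^ 2 + E) ≤ 4 / 27 * (C ^ 2)⁻¹ * m := by
    have h7 := mul_le_mul_of_nonneg_left hN (by positivity : 0 ≤ 4 / 27 * (C ^ 2)⁻¹)
    refine le_trans (le_of_eq ?_) h7
    field_simp
  have hkey : N * S ≤ F * (m * S / 3 - t * (2 * C ^ 2 + E)) := by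
    have h8 : F * (t * (2 * C ^ 2 + E)) ≤ 4 * C ^ 2 * (S * (2 * C ^ 2 + E)) := by gcongr
    have h9 : 4 / 9 * (C ^ 2)⁻¹ * (m * S / 3) ≤ F * (m * S / 3) := by gcongr
    have h10 := mul_le_mul_of_nonneg_right hc hS0.le
    nlinarith
  have hρδ : |ρ * δ| ≤ t * (2 * C ^ 2) := by
    rw [abs_mul, abs_of_pos (by linarith : 0 < ρ)]
    have := abs_le.2 h3
    nlinarith [abs_nonneg δ]
  have hρδ := abs_le.1 hρδ
  constructor
  · calc N * (R * S) = R * (N * S) := by ring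
      _ ≤ R * (F * (m * S / 3 - t * (2 * C ^ 2 + E))) := by gcongr
      _ = F * R * (m * S / 3 - t * (2 * C ^ 2 + E)) := by ring
      _ ≤ F * R * (ρ * (m * S / u - δ) + t * e) := by
        gcongr
        linarith
  · have : F * R * (ρ * (-(m * S / u) - δ) + t * e) ≤
        F * R * -(m * S / 3 - t * (2 * C ^ 2 + E)) := by
      gcongr
      linarith
    have h11 := mul_le_mul_of_nonneg_left hkey hR
    linarith

end ScalarBounds

/-! ### Smallness of powers of `t` near zero. -/

section Eventually

theorem tendsto_rpow_nhdsGT_zero {s : ℝ} (hs : 0 < s) :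
    Tendsto (fun t : ℝ => t ^ s) (𝓝[>] 0) (𝓝 0) := by
  have := (Real.continuousAt_rpow_const 0 s (Or.inr hs.le)).tendsto
  rw [Real.zero_rpow hs.ne'] at this
  exact this.mono_left nhdsWithin_le_nhds

theorem eventually_mul_rpow_le {a ε s : ℝ} (hs : 0 < s) (hε : 0 < ε) :
    ∀ᶠ t in 𝓝[>] (0 : ℝ), a * t ^ s ≤ ε := by
  have h := (tendsto_rpow_nhdsGT_zero hs).const_mul a
  rw [mul_zero] at h
  exact h.eventually (Iic_mem_nhds hε)

theorem eventually_mul_le {a ε : ℝ} (hε : 0 < ε) : ∀ᶠ t in 𝓝[>] (0 : ℝ), t * a ≤ ε := by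
  filter_upwards [eventually_mul_rpow_le (a := a) one_pos hε] with t ht
  rwa [Real.rpow_one, mul_comm] at ht

theorem eventually_le_mul_rpow {a r : ℝ} (ha : 0 < a) (hr : r < 0) (N : ℝ) :
    ∀ᶠ t in 𝓝[>] (0 : ℝ), N ≤ a * t ^ r :=
  ((tendsto_rpow_neg_nhdsGT_zero hr).const_mul_atTop ha).eventually_ge_atTop N

theorem exists_forall_Ioc_of_eventually {P : ℝ → Prop} (h : ∀ᶠ t in 𝓝[>] (0 : ℝ), P t) :
    ∃ τ > 0, ∀ t, 0 < t → t ≤ τ → P t := by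
  obtain ⟨τ, hτ, h'⟩ := mem_nhdsGT_iff_exists_Ioc_subset.1 h
  exact ⟨τ, hτ, fun t h0 h1 => h' ⟨h0, h1⟩⟩

end Eventually

section Pair
variable {M : Type*} [MetricSpace M] [ChartedSpace (EuclideanHalfSpace 3) M]

theorem exists_isRadialProfile_pair {φ : M → ℝ} {b C p τ₁ A A' σ σ' s : ℝ} (hp : 0 ≤ p)
    (hbp : b < p + 1) (hA : 0 < A) (hA' : 0 < A') (hC : 0 < C) (hs : 0 ≤ s) (hτ₁ : 0 < τ₁)
    (hτ₁' : τ₁ ≤ 1) (hτσ : |σ| * τ₁ ^ s ≤ 1 / 2) (hτσ' : |σ'| * τ₁ ^ s ≤ 1 / 2)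
    (hφ : ∀ x, 0 < bdryDist M x → bdryDist M x < τ₁ → C * bdryDist M x ^ b ≤ φ x) :
    ∃ c c' : ℝ, ∃ α > 0, ∃ β > 0, IsRadialProfile φ τ₁ p α β (radialFun A (p + 1) σ s c) ∧
      IsRadialProfile φ τ₁ p α β (radialFun A' (p + 1) σ' s c') := by
  obtain ⟨c, a, ha, h⟩ := exists_radialFun_bounds hp hA hs hτ₁ hτ₁' hτσ
  obtain ⟨c', a', ha', h'⟩ := exists_radialFun_bounds hp hA' hs hτ₁ hτ₁' hτσ'
  have h0 : 0 < max a a' := lt_max_of_lt_left (by linarith)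
  exact ⟨c, c', max a a', h0, max a a', h0,
    isRadialProfile_radialFun hbp hA hC hs hτ₁ hτσ hφ
      (h _ (le_max_left _ _) _ (le_max_left _ _)),
    isRadialProfile_radialFun hbp hA' hC hs hτ₁ hτσ' hφ
      (h' _ (le_max_right _ _) _ (le_max_right _ _))⟩

end Pair

/-! ### Choice of parameters and construction of the barriers. -/

section Barriers
variable {M : Type*} [MetricSpace M] [ChartedSpace (EuclideanHalfSpace 3) M]
  [IsManifold 𝕀 ∞ M] [RiemannianBundle (fun x : M => 𝕋 x)]
  [IsContMDiffRiemannianBundle 𝕀 ∞ (EuclideanSpace ℝ (Fin 3)) (fun x : M => 𝕋 x)]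
  [IsRiemannianManifold 𝕀 M]

theorem two_le_mul_radialFun_slope {C A Q T Φ u : ℝ} (hC : 0 < C) (hA : 0 < A) (hQ : 0 < Q)
    (hT : 0 < T) (hΦ : C⁻¹ ≤ Φ) (hu : 1 / 2 ≤ u) (h : 2 ≤ C⁻¹ * A / 2 * (T * Q)) :
    2 ≤ T * Φ * (A * Q * u) := by
  have hΦ0 : 0 < Φ := lt_of_lt_of_le (by positivity) hΦ
  calc 2 ≤ C⁻¹ * A / 2 * (T * Q) := h
    _ = T * C⁻¹ * (A * Q * (1 / 2)) := by ring
    _ ≤ _ := by gcongr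

theorem exists_barriers_of_nullExpansion_pos {τ₀ : ℝ}
    (hcollar : ContMDiffOn 𝕀 𝓘(ℝ, ℝ) ∞ (bdryDist M) {x | bdryDist M x < τ₀})
    {k : ∀ x : M, 𝕋 x →L[ℝ] 𝕋 x →L[ℝ] ℝ} {φ φtilde : M → ℝ} {b : ℝ}
    (hφtilde : ContMDiffOn 𝕀 𝓘(ℝ, ℝ) ∞ φtilde {x | bdryDist M x < τ₀})
    (hφ : ∀ x, bdryDist M x < τ₀ → φ x = bdryDist M x ^ b * φtilde x) {C δ : ℝ} (hC : 1 ≤ C)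
    (hδ : 0 < δ) (hδτ : δ ≤ τ₀)
    (hbound : ∀ x, 0 < bdryDist M x → bdryDist M x < δ →
      (∀ v w : 𝕋 x, |k x v w| ≤ C * ‖v‖ * ‖w‖) ∧ ‖diff φtilde x‖ ≤ C ∧ C⁻¹ ≤ φtilde x ∧
        φtilde x ≤ C) {l c : ℝ} (hl : 0 < l) (hc : 0 < c) (hb₁ : -((l - 1) / 2) ≤ b)
    (hb₂ : b < (l + 1) / 2)
    (hθ : ∀ x, 0 < bdryDist M x → bdryDist M x < τ₀ →
        c⁻¹ * bdryDist M x ^ l ≤ nullExpansion k (bdryDist M) x ∧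
        nullExpansion k (bdryDist M) x ≤ c * bdryDist M x ^ l) {lam : ℝ} (hlam : 0 < lam) :
    ∃ τ₁, 0 < τ₁ ∧ τ₁ ≤ τ₀ ∧ ∃ ψsub ψsup : ℝ → ℝ,
      (∃ α > 0, ∃ β > 0,
        IsRadialProfile φ τ₁ (b + (l - 1) / 2) α β ψsub ∧
        IsRadialProfile φ τ₁ (b + (l - 1) / 2) α β ψsup) ∧
      ∀ x, 0 < bdryDist M x → bdryDist M x < τ₁ →
        lam * bdryDist M x ^ l ≤ jangOperator φ k (fun y => ψsub (bdryDist M y)) x ∧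
        jangOperator φ k (fun y => ψsup (bdryDist M y)) x ≤ -(c⁻¹ / 2 * bdryDist M x ^ l) := by
  have hC0 : 0 < C := by linarith
  set p := b + (l - 1) / 2 with hp
  set d := p + 1 - 2 * b with hd
  have hd0 : 0 < d := by rw [hd, hp]; linarith
  have hpb : b - (p + 1) < 0 := by rw [hp]; linarith
  have hexp : 2 * (p + 1) - 2 * b - 1 = l := by rw [hp]; ring
  -- `A` makes the lower coefficient `d/(4A²C²)` equal to `lam + c`, where `c` pays for `θ₊`. `A'`
  -- makes the upper coefficient `2C²d/A'²` equal to `c⁻¹/2`, half of the lower bound on `θ₊`.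
  set A := √(d / (4 * C ^ 2 * (lam + c))) with hAdef
  set A' := √(4 * C ^ 2 * d * c) with hAdef'
  have hA2 : A ^ 2 = d / (4 * C ^ 2 * (lam + c)) := Real.sq_sqrt (by positivity)
  have hA2' : A' ^ 2 = 4 * C ^ 2 * d * c := Real.sq_sqrt (by positivity)
  have hA : 0 < A := Real.sqrt_pos.2 (by positivity)
  have hA' : 0 < A' := Real.sqrt_pos.2 (by positivity)
  set E := c + 4 * C with hE
  obtain ⟨τ, hτ, hsmall⟩ := exists_forall_Ioc_of_eventually
    ((eventually_mul_le (a := 2 * C ^ 2) (by positivity : 0 < d / 4)).and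
    ((eventually_mul_le (a := E) (by positivity : 0 < d / 8)).and
    ((eventually_le_mul_rpow (by positivity : 0 < C⁻¹ * A / 2) hpb 2).and
    (eventually_le_mul_rpow (by positivity : 0 < C⁻¹ * A' / 2) hpb 2))))
  set τ₁ := min (min δ 1) τ
  have hτ₁ : 0 < τ₁ := lt_min (lt_min hδ one_pos) hτ
  have hτ₁δ : τ₁ ≤ δ := (min_le_left _ _).trans (min_le_left _ _)
  have hτ₁1 : τ₁ ≤ 1 := (min_le_left _ _).trans (min_le_right _ _)
  -- The ansatz is a pure power here: `σ = 0`, and the value of `s` is immaterial.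
  obtain ⟨a, a', α, hα, β, hβ, hprof⟩ := exists_isRadialProfile_pair (φ := φ) (b := b)
    (C := C⁻¹) (p := p) (τ₁ := τ₁) (A := A) (A' := A') (σ := 0) (σ' := 0) (s := 1)
    (by rw [hp]; linarith) (by linarith) hA hA' (by positivity) zero_le_one hτ₁ hτ₁1
    (by norm_num) (by norm_num) (fun x hx hx' => by
      rw [hφ x ((hx'.trans_le hτ₁δ).trans_le hδτ), mul_comm]
      have := (hbound x hx (hx'.trans_le hτ₁δ)).2.2.1
      gcongr)
  refine ⟨τ₁, hτ₁, hτ₁δ.trans hδτ, _, _, ⟨α, hα, β, hβ, hprof⟩, fun x hx hx' => ?_⟩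
  obtain ⟨hk, hdφ, hΦ, hΦ'⟩ := hbound x hx (hx'.trans_le hτ₁δ)
  have hx₀ : bdryDist M x < τ₀ := (hx'.trans_le hτ₁δ).trans_le hδτ
  obtain ⟨h1, h2, h3, h3'⟩ := hsmall _ hx (hx'.le.trans (min_le_right _ _))
  obtain ⟨hθ1, hθ2⟩ := hθ x hx hx₀
  have htl : 0 < bdryDist M x ^ l := Real.rpow_pos_of_pos hx l
  have htl1 : bdryDist M x ^ l ≤ 1 := Real.rpow_le_one hx.le (hx'.le.trans hτ₁1) hl.le
  have hθabs : |nullExpansion k (bdryDist M) x| ≤ c := by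
    rw [abs_of_nonneg (le_trans (by positivity) hθ1)]
    nlinarith
  have hΦ0 : 0 < φtilde x := lt_of_lt_of_le (by positivity) hΦ
  have key : ∀ B a : ℝ, 0 < B → 2 ≤ C⁻¹ * B / 2 * bdryDist M x ^ (b - (p + 1)) →
      d / (4 * B ^ 2 * C ^ 2) * bdryDist M x ^ l ≤
          jangOperator φ k (fun y => radialFun B (p + 1) 0 1 a (bdryDist M y)) x
            + nullExpansion k (bdryDist M) x ∧
        jangOperator φ k (fun y => radialFun B (p + 1) 0 1 a (bdryDist M y)) x
            + nullExpansion k (bdryDist M) x ≤ 2 * C ^ 2 * d / B ^ 2 * bdryDist M x ^ l := by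
    intro B a hB hB2
    rw [sub_eq_add_neg, Real.rpow_add hx] at hB2
    obtain ⟨ρ, e, D, hρ, hρ', he, hD, heq⟩ := jangOperator_radialFun hcollar hφtilde hφ hx hx₀
      hC0.le hk hdφ hΦ0 (A := B) (q := p + 1) (σ := 0) (s := 1) (c := a) hB (by norm_num)
      (two_le_mul_radialFun_slope hC0 hB (Real.rpow_pos_of_pos hx _)
        (Real.rpow_pos_of_pos hx _) hΦ (by norm_num) hB2)
    rw [heq, hexp, ← hd]
    simp only [zero_mul, add_zero, zero_div, sub_zero, one_pow, mul_one]
    exact power_expansion_bounds hB hC hd0 hx hΦ hΦ' hD (he.trans (by rw [hE]; linarith))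
      hρ hρ' htl.le h1 h2
  constructor
  · have h := (key A a hA h3).1
    have : d / (4 * A ^ 2 * C ^ 2) = lam + c := by rw [hA2]; field_simp
    rw [this] at h
    linarith
  · have h := (key A' a' hA' h3').2
    have : 2 * C ^ 2 * d / A' ^ 2 = c⁻¹ / 2 := by rw [hA2']; field_simp; norm_num
    rw [this] at h
    linarith

theorem exists_barriers_of_abs_nullExpansion_le {τ₀ : ℝ}
    (hcollar : ContMDiffOn 𝕀 𝓘(ℝ, ℝ) ∞ (bdryDist M) {x | bdryDist M x < τ₀})
    {k : ∀ x : M, 𝕋 x →L[ℝ] 𝕋 x →L[ℝ] ℝ} {φ φtilde : M → ℝ} {b : ℝ}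
    (hφtilde : ContMDiffOn 𝕀 𝓘(ℝ, ℝ) ∞ φtilde {x | bdryDist M x < τ₀})
    (hφ : ∀ x, bdryDist M x < τ₀ → φ x = bdryDist M x ^ b * φtilde x) {C δ : ℝ} (hC : 1 ≤ C)
    (hδ : 0 < δ) (hδτ : δ ≤ τ₀)
    (hbound : ∀ x, 0 < bdryDist M x → bdryDist M x < δ →
      (∀ v w : 𝕋 x, |k x v w| ≤ C * ‖v‖ * ‖w‖) ∧ ‖diff φtilde x‖ ≤ C ∧ C⁻¹ ≤ φtilde x ∧
        φtilde x ≤ C) {l c : ℝ} (hl : 0 < l) (hc : 0 < c) (hb : 1 / 2 ≤ b)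
    (hθ : ∀ x, 0 < bdryDist M x → bdryDist M x < τ₀ →
        |nullExpansion k (bdryDist M) x| ≤ c * bdryDist M x ^ l) {ltilde : ℝ}
    (hlt : 2 * b - 1 < ltilde) (hlt' : ltilde ≤ min l (2 * b)) {lam : ℝ} (hlam : 0 < lam) :
    ∃ τ₁, 0 < τ₁ ∧ τ₁ ≤ τ₀ ∧ ∃ χsub χsup : ℝ → ℝ,
      (∃ α > 0, ∃ β > 0,
        IsRadialProfile φ τ₁ (2 * b - 1) α β χsub ∧
        IsRadialProfile φ τ₁ (2 * b - 1) α β χsup) ∧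
      ∀ x, 0 < bdryDist M x → bdryDist M x < τ₁ →
        lam * bdryDist M x ^ ltilde ≤ jangOperator φ k (fun y => χsub (bdryDist M y)) x ∧
        jangOperator φ k (fun y => χsup (bdryDist M y)) x ≤ -(lam * bdryDist M x ^ ltilde) := by
  have hC0 : 0 < C := by linarith
  set p := 2 * b - 1 with hp
  set s := ltilde - p with hs
  have hs0 : 0 < s := by linarith
  have hs1 : s ≤ 1 := by have := hlt'.trans (min_le_right _ _); rw [hs, hp]; linarith
  have hpb : b - (p + 1) < 0 := by rw [hp]; linarith
  have hexp : 2 * (p + 1) - 2 * b - 1 = p := by rw [hp]; ring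
  have hq : p + 1 - 2 * b = 0 := by rw [hp]; ring
  set E := c + 4 * C with hE
  -- The correction enters the expansion as `m * s`, hence the division by `s`. The target is `lam +
  -- c`, so that `lam` remains after `|θ₊| ≤ c t^ltilde` is subtracted.
  set m := 27 / 4 * C ^ 2 * (lam + c + 4 * C ^ 2 * (2 * C ^ 2 + E)) / s with hm
  have hm0 : 0 < m := by positivity
  have hms : m * s = 27 / 4 * C ^ 2 * (lam + c + 4 * C ^ 2 * (2 * C ^ 2 + E)) :=
    div_mul_cancel₀ _ hs0.ne'
  obtain ⟨τ, hτ, hsmall⟩ := exists_forall_Ioc_of_eventually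
    ((eventually_mul_rpow_le (a := m) hs0 (by norm_num : (0 : ℝ) < 1 / 2)).and
    (eventually_le_mul_rpow (by positivity : 0 < C⁻¹ * 1 / 2) hpb 2))
  set τ₁ := min (min δ 1) τ
  have hτ₁ : 0 < τ₁ := lt_min (lt_min hδ one_pos) hτ
  have hτ₁δ : τ₁ ≤ δ := (min_le_left _ _).trans (min_le_left _ _)
  have hτ₁1 : τ₁ ≤ 1 := (min_le_left _ _).trans (min_le_right _ _)
  have hτσ : |m| * τ₁ ^ s ≤ 1 / 2 := by
    rw [abs_of_pos hm0]
    exact (hsmall _ hτ₁ (min_le_right _ _)).1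
  have hτσ' : |-m| * τ₁ ^ s ≤ 1 / 2 := by rwa [abs_neg]
  -- The coefficient becomes `-σ s t^s / (1 + σ t^s)`, so `σ = -m` gives the subsolution and `σ = m`
  -- the supersolution.
  obtain ⟨a, a', α, hα, β, hβ, hprof⟩ := exists_isRadialProfile_pair (φ := φ) (b := b)
    (C := C⁻¹) (p := p) (τ₁ := τ₁) (A := 1) (A' := 1) (σ := -m) (σ' := m) (s := s)
    (by rw [hp]; linarith) (by linarith) one_pos one_pos (by positivity) hs0.le hτ₁ hτ₁1
    hτσ' hτσ (fun x hx hx' => by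
      rw [hφ x ((hx'.trans_le hτ₁δ).trans_le hδτ), mul_comm]
      have := (hbound x hx (hx'.trans_le hτ₁δ)).2.2.1
      gcongr)
  refine ⟨τ₁, hτ₁, hτ₁δ.trans hδτ, _, _, ⟨α, hα, β, hβ, hprof⟩, fun x hx hx' => ?_⟩
  obtain ⟨hk, hdφ, hΦ, hΦ'⟩ := hbound x hx (hx'.trans_le hτ₁δ)
  have hx₀ : bdryDist M x < τ₀ := (hx'.trans_le hτ₁δ).trans_le hδτ
  have hB2 := (hsmall _ hx (hx'.le.trans (min_le_right _ _))).2
  rw [sub_eq_add_neg, Real.rpow_add hx] at hB2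
  have hx1 : bdryDist M x ≤ 1 := hx'.le.trans hτ₁1
  have htl1 : bdryDist M x ^ l ≤ 1 := Real.rpow_le_one hx.le hx1 hl.le
  have hll : bdryDist M x ^ l ≤ bdryDist M x ^ ltilde :=
    Real.rpow_le_rpow_of_exponent_ge hx hx1 (hlt'.trans (min_le_left _ _))
  have hθx := hθ x hx hx₀
  have hθabs : |nullExpansion k (bdryDist M) x| ≤ c := hθx.trans (by nlinarith)
  have hθlt := abs_le.1 (hθx.trans (mul_le_mul_of_nonneg_left hll hc.le))
  have hΦ0 : 0 < φtilde x := lt_of_lt_of_le (by positivity) hΦ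
  -- This is where `ltilde ≤ 2b`, that is `s ≤ 1`, matters: the `O(t)` errors are no larger than the
  -- correction of order `t^s`.
  have htS : bdryDist M x ≤ bdryDist M x ^ s := by
    simpa using Real.rpow_le_rpow_of_exponent_ge hx hx1 hs1
  have hRS : bdryDist M x ^ p * bdryDist M x ^ s = bdryDist M x ^ ltilde := by
    rw [← Real.rpow_add hx, hs]; congr 1; ring
  have hR : 0 ≤ bdryDist M x ^ p := (Real.rpow_pos_of_pos hx p).le
  have hms0 : 0 ≤ m * s := by positivity
  constructor
  · obtain ⟨hu, hu'⟩ := half_le_one_add_mul_rpow hs0.le hτσ' hx hx'.le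
    obtain ⟨ρ, e, D, hρ, hρ', he, hD, heq⟩ := jangOperator_radialFun hcollar hφtilde hφ hx hx₀
      hC0.le hk hdφ hΦ0 (A := 1) (q := p + 1) (σ := -m) (s := s) (c := a) one_pos (by linarith)
      (two_le_mul_radialFun_slope hC0 one_pos (Real.rpow_pos_of_pos hx _)
        (Real.rpow_pos_of_pos hx _) hΦ hu hB2)
    have h := (perturbed_expansion_bound hC hx htS hu hu' hΦ hΦ' hD
      (he.trans (by rw [hE]; linarith)) hρ hρ' hR hms0 hms.ge).1
    have hrw : ∀ w z : ℝ, 0 - -m * s * bdryDist M x ^ s / w - z =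
      m * s * bdryDist M x ^ s / w - z := fun w z => by ring
    rw [hexp, hq, hrw, one_pow, one_mul] at heq
    rw [← heq, hRS] at h
    linarith
  · obtain ⟨hu, hu'⟩ := half_le_one_add_mul_rpow hs0.le hτσ hx hx'.le
    obtain ⟨ρ, e, D, hρ, hρ', he, hD, heq⟩ := jangOperator_radialFun hcollar hφtilde hφ hx hx₀
      hC0.le hk hdφ hΦ0 (A := 1) (q := p + 1) (σ := m) (s := s) (c := a') one_pos (by linarith)
      (two_le_mul_radialFun_slope hC0 one_pos (Real.rpow_pos_of_pos hx _)
        (Real.rpow_pos_of_pos hx _) hΦ hu hB2)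
    have h := (perturbed_expansion_bound hC hx htS hu hu' hΦ hΦ' hD
      (he.trans (by rw [hE]; linarith)) hρ hρ' hR hms0 hms.ge).2
    rw [hexp, hq, zero_sub, one_pow, one_mul] at heq
    rw [← heq, hRS] at h
    linarith

end Barriers

end Jang

end

theorem lemma6p1
    {M : Type*} [MetricSpace M] [ChartedSpace (EuclideanHalfSpace 3) M]
    [IsManifold (modelWithCornersEuclideanHalfSpace 3) ∞ M]
    [RiemannianBundle (fun x : M => TangentSpace (modelWithCornersEuclideanHalfSpace 3) x)]
    [IsContMDiffRiemannianBundle (modelWithCornersEuclideanHalfSpace 3) ∞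
      (EuclideanSpace ℝ (Fin 3))
      (fun x : M => TangentSpace (modelWithCornersEuclideanHalfSpace 3) x)]
    [IsRiemannianManifold (modelWithCornersEuclideanHalfSpace 3) M]
    -- the boundary is compact
    (hM : IsCompact ((modelWithCornersEuclideanHalfSpace 3).boundary M))
    -- `k` is a smooth symmetric two-tensor
    (k : ∀ x : M, TangentSpace (modelWithCornersEuclideanHalfSpace 3) x →L[ℝ]
      TangentSpace (modelWithCornersEuclideanHalfSpace 3) x →L[ℝ] ℝ)
    (hk_smooth : ContMDiff (modelWithCornersEuclideanHalfSpace 3)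
      ((modelWithCornersEuclideanHalfSpace 3).prod
        𝓘(ℝ, EuclideanSpace ℝ (Fin 3) →L[ℝ] EuclideanSpace ℝ (Fin 3) →L[ℝ] ℝ)) ∞
      (fun x => TotalSpace.mk'
        (EuclideanSpace ℝ (Fin 3) →L[ℝ] EuclideanSpace ℝ (Fin 3) →L[ℝ] ℝ) x (k x)))
    (hk_symm : ∀ x v w, k x v w = k x w v)
    -- in the collar `τ < τ₀` the distance `τ` to the boundary is smooth up to the boundary
    (τ₀ : ℝ) (hτ₀ : 0 < τ₀)
    (hcollar : ContMDiffOn (modelWithCornersEuclideanHalfSpace 3) 𝓘(ℝ, ℝ) ∞ (Jang.bdryDist M)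
      {x | Jang.bdryDist M x < τ₀})
    -- `φ = τ ^ b * φtilde` in the collar, with `φtilde` smooth up to the boundary and positive
    (φ φtilde : M → ℝ) (b : ℝ) (hb : 0 ≤ b)
    (hφtilde_smooth : ContMDiffOn (modelWithCornersEuclideanHalfSpace 3) 𝓘(ℝ, ℝ) ∞ φtilde
      {x | Jang.bdryDist M x < τ₀})
    (hφtilde_pos : ∀ x, Jang.bdryDist M x < τ₀ → 0 < φtilde x)
    (hφ : ∀ x, Jang.bdryDist M x < τ₀ → φ x = Jang.bdryDist M x ^ b * φtilde x)
    (l c : ℝ) (hl : 0 < l) (hc : 0 < c) :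
    (-((l - 1) / 2) ≤ b → b < (l + 1) / 2 →
      (∀ x, 0 < Jang.bdryDist M x → Jang.bdryDist M x < τ₀ →
        c⁻¹ * Jang.bdryDist M x ^ l ≤ Jang.nullExpansion k (Jang.bdryDist M) x ∧
        Jang.nullExpansion k (Jang.bdryDist M) x ≤ c * Jang.bdryDist M x ^ l) →
      ∀ lam > 0, ∃ τ₁, 0 < τ₁ ∧ τ₁ ≤ τ₀ ∧ ∃ ψsub ψsup : ℝ → ℝ,
        (∃ α > 0, ∃ β > 0,
          Jang.IsRadialProfile φ τ₁ (b + (l - 1) / 2) α β ψsub ∧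
          Jang.IsRadialProfile φ τ₁ (b + (l - 1) / 2) α β ψsup) ∧
        ∀ x, 0 < Jang.bdryDist M x → Jang.bdryDist M x < τ₁ →
          lam * Jang.bdryDist M x ^ l
            ≤ Jang.jangOperator φ k (fun y => ψsub (Jang.bdryDist M y)) x ∧
          Jang.jangOperator φ k (fun y => ψsup (Jang.bdryDist M y)) x
            ≤ -(c⁻¹ / 2 * Jang.bdryDist M x ^ l)) ∧
    (1 / 2 ≤ b → b < (l + 1) / 2 →
      (∀ x, 0 < Jang.bdryDist M x → Jang.bdryDist M x < τ₀ →
        |Jang.nullExpansion k (Jang.bdryDist M) x| ≤ c * Jang.bdryDist M x ^ l) →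
      ∀ ltilde, 2 * b - 1 < ltilde → ltilde ≤ min l (2 * b) →
      ∀ lam > 0, ∃ τ₁, 0 < τ₁ ∧ τ₁ ≤ τ₀ ∧ ∃ χsub χsup : ℝ → ℝ,
        (∃ α > 0, ∃ β > 0,
          Jang.IsRadialProfile φ τ₁ (2 * b - 1) α β χsub ∧
          Jang.IsRadialProfile φ τ₁ (2 * b - 1) α β χsup) ∧
        ∀ x, 0 < Jang.bdryDist M x → Jang.bdryDist M x < τ₁ →
          lam * Jang.bdryDist M x ^ ltilde
            ≤ Jang.jangOperator φ k (fun y => χsub (Jang.bdryDist M y)) x ∧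
          Jang.jangOperator φ k (fun y => χsup (Jang.bdryDist M y)) x
            ≤ -(lam * Jang.bdryDist M x ^ ltilde)) := by
  obtain ⟨C, hC, δ, hδ, hδτ, hbound⟩ :=
    Jang.exists_collar_bounds hM hk_smooth.continuous hτ₀ hφtilde_smooth hφtilde_pos
  exact ⟨fun hb₁ hb₂ hθ lam hlam => Jang.exists_barriers_of_nullExpansion_pos hcollar
      hφtilde_smooth hφ hC hδ hδτ hbound hl hc hb₁ hb₂ hθ hlam,
    fun hb₁ _ hθ ltilde hlt hlt' lam hlam => Jang.exists_barriers_of_abs_nullExpansion_le hcollar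
      hφtilde_smooth hφ hC hδ hδτ hbound hl hc hb₁ hθ hlt hlt' hlam⟩
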